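/- Throughout, $\overline{\mathbb R}=(-\infty,\infty]$, $\operatorname{dom}\varphi=\{x:\varphi(x)<\infty\}$, and $\partial$ denotes the limiting (Mordukhovich) subdifferential: $v\in\partial\varphi(\bar x)$ iff $(v,-1)$ is a limiting normal to $\operatorname{epi}\varphi$ at $(\bar x,\varphi(\bar x))$. The subderivative and the second subderivative of $\varphi$ at $\bar x\in\operatorname{dom}\varphi$ are $$d\varphi(\bar x)(w)=\liminf_{t\downarrow0,\,u\to w}\frac{\varphi(\bar x+tu)-\varphi(\bar x)}{t},\qquad d^2\varphi(\bar x,\bar v)(w)=\liminf_{t\downarrow0,\,u\to w}\frac{\varphi(\bar x+tu)-\varphi(\bar x)-t\langle\bar v,u\rangle}{\frac12t^2},$$ and the critical cone is $K_\varphi(\bar x,\bar v)=\{w: d\varphi(\bar x)(w)=\langle\bar v,w\rangle\}$. A function $\vartheta$ is piecewise linear-quadratic if $\operatorname{dom}\vartheta$ is a union of finitely many polyhedral convex sets, on each of which $\vartheta(y)=\frac12\langle Ay,y\rangle+\langle a,y\rangle+\alpha$ for some symmetric matrix $A$, vector $a$ and real $\alpha$ (depending on the set). **Corollary 5.3.**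 Let $\varphi:\mathbb R^n\to\overline{\mathbb R}$ be fully subamenable at $\bar x\in\operatorname{dom}\varphi$, that is, $\varphi=\vartheta\circ f$ on a neighborhood of $\bar x$, where $f:\mathbb R^n\to\mathbb R^m$ is twice differentiable at $\bar x$ (differentiable around $\bar x$ with derivative differentiable at $\bar x$), $\vartheta:\mathbb R^m\to\overline{\mathbb R}$ is convex and piecewise linear-quadratic, and for some $\kappa\ge0$ $$\operatorname{dist}\bigl(x;\{z: f(z)\in\operatorname{dom}\vartheta\}\bigr)\le\kappa\operatorname{dist}\bigl(f(x);\operatorname{dom}\vartheta\bigr)\quad\text{for all }x\text{ near }\bar x.$$ Let $\bar v\in\partial\varphi(\bar x)$, let $\Lambda(\bar x,\bar v)=\{\lambda\in\mathbb R^m:\nabla f(\bar x)^*\lambda=\bar v,\ \lambda\in\partial\vartheta(f(\bar x))\}$, and let $\bar\lambda\in\Lambda(\bar x,\bar v)$. Then: (i) For every $w\in\mathbb R^n$, $$d^2\varphi(\bar x,\bar v)(w)=d^2\vartheta(f(\bar x),\bar\lambda)(\nabla f(\bar x)w)+\sup_{\lambda\in\Lambda(\bar x,\bar v)}\langle\lambda,\nabla^2f(\bar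 x)(w,w)\rangle$$ in the extended reals, and the supremum is attained (it is a maximum) for every $w\in K_\varphi(\bar x,\bar v)$. (ii) There is $\bar r>0$ such that for all $r>\bar r$ and all $w\in\mathbb R^n$, $$d^2\varphi(\bar x,\bar v)(w)=d^2\vartheta(f(\bar x),\bar\lambda)(\nabla f(\bar x)w)+\max_{\lambda\in\Lambda(\bar x,\bar v),\ \|\lambda\|\le r}\langle\lambda,\nabla^2f(\bar x)(w,w)\rangle,$$ where the maximum is attained. -/

import Mathlib

open Filter Topology
open scoped InnerProductSpace

noncomputable section

namespace VarAnalysis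

/-! Extended-real-valued functions are functions into `EReal`; the functions occurring below take
their values in `(-∞, ∞]` near the points of interest. -/

section General

variable {E F : Type*} [NormedAddCommGroup E] [InnerProductSpace ℝ E]
  [NormedAddCommGroup F] [InnerProductSpace ℝ F]

/-- The effective domain `{x | φ x < ∞}`. -/
def dom (φ : E → EReal) : Set E := {x | φ x < ⊤}

/-- The epigraph, as a subset of `E × ℝ` with its Hilbert space structure. -/
def epi (φ : E → EReal) : Set (WithLp 2 (E × ℝ)) := {p | φ p.fst ≤ (p.snd : EReal)}

/-- The regular (Fréchet) normal cone to `Ω` at `x`: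
`limsup ⟪v, y - x⟫ / ‖y - x‖ ≤ 0` as `y → x` with `y ∈ Ω`, `y ≠ x`. -/
def regularNormalCone (Ω : Set E) (x : E) : Set E :=
  {v | ∀ ε : ℝ, 0 < ε → ∀ᶠ y in 𝓝[Ω] x, ⟪v, y - x⟫_ℝ ≤ ε * ‖y - x‖}

/-- The limiting (Mordukhovich) normal cone to `Ω` at `x`. -/
def limitingNormalCone (Ω : Set E) (x : E) : Set E :=
  {v | ∃ (y : ℕ → E) (u : ℕ → E), (∀ k, y k ∈ Ω) ∧ Tendsto y atTop (𝓝 x) ∧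
    Tendsto u atTop (𝓝 v) ∧ ∀ k, u k ∈ regularNormalCone Ω (y k)}

/-- The limiting subdifferential of `φ` at a point `x` where `φ` is finite:
`v ∈ ∂φ(x)` iff `(v, -1)` is a limiting normal to the epigraph at `(x, φ x)`. -/
def subdifferential (φ : E → EReal) (x : E) : Set E :=
  {v | WithLp.toLp 2 (v, (-1 : ℝ)) ∈
    limitingNormalCone (epi φ) (WithLp.toLp 2 (x, (φ x).toReal))}

/-- The subderivative `dφ(x)(w) = liminf (φ (x + t u) - φ x) / t` as `t ↓ 0`, `u → w`. -/
def subderivative (φ : E → EReal) (x w : E) : EReal :=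
  liminf (fun p : ℝ × E => (φ (x + p.1 • p.2) - φ x) / (p.1 : EReal)) (𝓝[>] (0 : ℝ) ×ˢ 𝓝 w)

/-- The second-order difference quotient
`(φ (x + t u) - φ x - t ⟪v, u⟫) / (t ^ 2 / 2)`. -/
def secondQuotient (φ : E → EReal) (x v : E) (t : ℝ) (u : E) : EReal :=
  (φ (x + t • u) - φ x - ((t * ⟪v, u⟫_ℝ : ℝ) : EReal)) / ((1 / 2 * t ^ 2 : ℝ) : EReal)

/-- The second subderivative `d²φ(x, v)(w)`: the lower limit of the second-order difference
quotients as `t ↓ 0`, `u → w`. -/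
def secondSubderivative (φ : E → EReal) (x v w : E) : EReal :=
  liminf (fun p : ℝ × E => secondQuotient φ x v p.1 p.2) (𝓝[>] (0 : ℝ) ×ˢ 𝓝 w)

/-- The critical cone `K_φ(x, v) = {w | dφ(x)(w) = ⟪v, w⟫}`. -/
def criticalCone (φ : E → EReal) (x v : E) : Set E :=
  {w | subderivative φ x w = ((⟪v, w⟫_ℝ : ℝ) : EReal)}

/-- Polyhedral convex sets: finite intersections of closed half-spaces (no half-space gives the
whole space; a half-space with normal vector `0` may be empty). -/
def IsPolyhedralConvex (P : Set E) : Prop :=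
  ∃ (k : ℕ) (a : Fin k → E) (b : Fin k → ℝ), P = {x | ∀ j, ⟪a j, x⟫_ℝ ≤ b j}

/-- Piecewise linear-quadratic functions. -/
def IsPWLQ (θ : E → EReal) : Prop :=
  ∃ (s : ℕ) (Ω : Fin s → Set E) (A : Fin s → E →ₗ[ℝ] E) (a : Fin s → E) (α : Fin s → ℝ),
    (∀ i, IsPolyhedralConvex (Ω i)) ∧ (∀ i, (A i).IsSymmetric) ∧ dom θ = ⋃ i, Ω i ∧
    ∀ i, ∀ x ∈ Ω i, θ x = ((1 / 2 * ⟪A i x, x⟫_ℝ + ⟪a i, x⟫_ℝ + α i : ℝ) : EReal)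

/-- `f` is twice differentiable at `x`: it is differentiable around `x` and its derivative is
differentiable at `x`. -/
def TwiceDifferentiableAt (f : E → F) (x : E) : Prop :=
  (∀ᶠ y in 𝓝 x, DifferentiableAt ℝ f y) ∧ DifferentiableAt ℝ (fderiv ℝ f) x

/-- The second derivative `∇²f(x)(w, u)`. -/
def secondDeriv (f : E → F) (x w u : E) : F := fderiv ℝ (fderiv ℝ f) x w u

/-- The metric subregularity qualification condition for the composition `θ ∘ f` at `x`: for some
constant `κ ≥ 0`, `dist (y; {z | f z ∈ dom θ}) ≤ κ dist (f y; dom θ)` for all `y` near `x`. -/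
def MSQC (f : E → F) (θ : F → EReal) (x : E) : Prop :=
  ∃ κ : ℝ, 0 ≤ κ ∧ ∀ᶠ y in 𝓝 x,
    Metric.infDist y {z | f z ∈ dom θ} ≤ κ * Metric.infDist (f y) (dom θ)

/-- `φ` is fully subamenable at `x ∈ dom φ`, with the local representation `φ = θ ∘ f`. -/
structure IsFullySubamenableWith (φ : E → EReal) (f : E → F) (θ : F → EReal) (x : E) : Prop where
  mem_dom : x ∈ dom φ
  eq_comp : ∀ᶠ y in 𝓝 x, φ y = θ (f y)
  twiceDiff : TwiceDifferentiableAt f x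
  convex : Convex ℝ (epi θ)
  pwlq : IsPWLQ θ
  msqc : MSQC f θ x

/-- The multiplier set `Λ(x, v) = {λ | ∇f(x)* λ = v, λ ∈ ∂θ(f x)}`. -/
def multipliers [CompleteSpace E] [CompleteSpace F] (f : E → F) (θ : F → EReal) (x v : E) :
    Set F :=
  {l | ContinuousLinearMap.adjoint (fderiv ℝ f x) l = v ∧ l ∈ subdifferential θ (f x)}

end General

end VarAnalysis

end

/-! Write `L = ∇f(x)` and `q = ∇²f(x)(w,w)`. Near `f x` the domain of `θ` consists of finitely many
translated polyhedral cones, with `θ` quadratic on each (`PLQGerm`). Hence `d²θ(f x, λ)(L w)` is the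
curvature of any piece containing `L w` if that direction is critical, and `∞` otherwise.
Criticality only compares the slope of `θ` along `L w` with `⟪λ, L w⟫ = ⟪v, w⟫`, so neither case
depends on the multiplier.

Lower bound: a Taylor expansion of `f` turns quotients of `φ` into quotients of `θ` plus `⟪λ, q⟫`,
for every multiplier `λ` (`coe_add_inner_le_secondSubderivative`). This settles noncritical
directions, where both sides are `∞`.

Upper bound in critical directions: the multipliers form a polyhedron, and maximizing `⟪·, q⟫` over
it is a linear program. A dual solution writes `q` as a conic combination of the constraint vectors.
Each of these is realized by a curve in `dom θ` with the right slope, and by convexity so is `q`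
(`IsRecoverable.sum`, `PLQGerm.exists_multipliers_eq`). The result is a parabolic arc in `dom θ`
with second-order value at most curvature plus maximum. Metric subregularity and the Lipschitz
property of `θ` on its domain pull it back to `dom φ` with error `o(t²)`
(`exists_secondSubderivative_le`).

The uniform radius comes from choosing maximizers in a finite set, one point for each face of the
polyhedron (`exists_radius_isMaxOn_polyhedron`). -/

namespace VarAnalysis

/-! ### Polyhedral cones, Farkas' lemma and linear programming -/

section Polyhedral

variable {V F : Type*} [NormedAddCommGroup V] [InnerProductSpace ℝ V]
  [NormedAddCommGroup F] [InnerProductSpace ℝ F]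

/-- A half-line parameter satisfying finitely many linear inequalities exists as soon as every
lower bound is below every upper bound. -/
theorem exists_nonneg_forall_mul_le {ι : Type*} (A : Finset ι) (α β : ι → ℝ)
    (h0 : ∀ i ∈ A, β i ≤ 0 → α i ≤ 0)
    (h1 : ∀ i ∈ A, ∀ j ∈ A, 0 < β i → β j < 0 → β i * α j - β j * α i ≤ 0) :
    ∃ t : ℝ, 0 ≤ t ∧ ∀ i ∈ A, α i ≤ t * β i := by
  classical
  by_cases hne : (A.filter fun i => 0 < β i).Nonempty
  · obtain ⟨k, hk, hmax⟩ := Finset.exists_max_image _ (fun i => α i / β i) hne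
    rw [Finset.mem_filter] at hk
    refine ⟨max 0 (α k / β k), le_max_left _ _, fun i hi => ?_⟩
    rcases lt_trichotomy (β i) 0 with hb | hb | hb
    · rcases max_cases (0 : ℝ) (α k / β k) with ⟨h, -⟩ | ⟨h, -⟩ <;> rw [h]
      · simpa using h0 i hi hb.le
      · rw [div_mul_eq_mul_div, le_div_iff₀ hk.2]
        linarith [h1 k hk.1 i hi hk.2 hb]
    · simpa [hb] using h0 i hi hb.le
    · rw [← div_le_iff₀ hb]
      exact (hmax i (by simp [hi, hb])).trans (le_max_right _ _)
  · refine ⟨0, le_rfl, fun i hi => ?_⟩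
    have : β i ≤ 0 := by
      by_contra hc
      exact hne ⟨i, by simp [hi, not_le.mp hc]⟩
    simpa using h0 i hi this

/-- Weyl's theorem: a finitely generated cone is a finite intersection of half-spaces. -/
theorem exists_finset_mem_hull_iff [FiniteDimensional ℝ V] (s : Finset V) :
    ∃ A : Finset V, ∀ x, x ∈ PointedCone.hull ℝ (s : Set V) ↔ ∀ a ∈ A, ⟪a, x⟫_ℝ ≤ 0 := by
  classical
  induction s using Finset.induction_on with
  | empty =>
    let b := stdOrthonormalBasis ℝ V
    refine ⟨Finset.univ.image (fun i => b i) ∪ Finset.univ.image (fun i => -b i), fun x => ?_⟩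
    constructor
    · intro hx
      have : x = 0 := by simpa [PointedCone.hull] using hx
      simp [this]
    · intro hx
      have : x = 0 := by
        apply b.repr.injective
        ext i
        have h1 := hx (b i) (by simp)
        have h2 := hx (-b i) (by simp)
        rw [inner_neg_left] at h2
        rw [b.repr_apply_apply, map_zero]
        exact le_antisymm h1 (by simpa using h2)
      rw [this]
      exact Submodule.zero_mem _
  | insert g s hg ih =>
    obtain ⟨A, hA⟩ := ih
    -- Fourier–Motzkin elimination of the coefficient `t` of `g`: normals nonpositive on `g` are
    -- kept, and each pair of opposite signs is combined so that the value on `g` cancels.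
    refine ⟨A.filter (fun a => ⟪a, g⟫_ℝ ≤ 0) ∪
      ((A ×ˢ A).filter (fun p => 0 < ⟪p.1, g⟫_ℝ ∧ ⟪p.2, g⟫_ℝ < 0)).image
        (fun p => ⟪p.1, g⟫_ℝ • p.2 - ⟪p.2, g⟫_ℝ • p.1), fun x => ?_⟩
    have key : x ∈ PointedCone.hull ℝ ((insert g s : Finset V) : Set V) ↔
        ∃ t : ℝ, 0 ≤ t ∧ x - t • g ∈ PointedCone.hull ℝ (s : Set V) := by
      rw [Finset.coe_insert]
      unfold PointedCone.hull
      rw [Submodule.mem_span_insert]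
      constructor
      · rintro ⟨a, z, hz, rfl⟩
        refine ⟨a, a.2, ?_⟩
        have : a • g + z - (a : ℝ) • g = z := by
          rw [show a • g = (a : ℝ) • g from rfl]; abel
        rwa [this]
      · rintro ⟨t, ht, h⟩
        refine ⟨⟨t, ht⟩, _, h, ?_⟩
        rw [show (⟨t, ht⟩ : {c : ℝ // 0 ≤ c}) • g = t • g from rfl]; abel
    rw [key]
    constructor
    · rintro ⟨t, ht, hx⟩ a ha
      rw [hA] at hx
      have hx' : ∀ a ∈ A, ⟪a, x⟫_ℝ ≤ t * ⟪a, g⟫_ℝ := fun a ha => by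
        have := hx a ha
        rw [inner_sub_right, inner_smul_right] at this
        linarith
      rw [Finset.mem_union, Finset.mem_filter, Finset.mem_image] at ha
      rcases ha with ⟨ha, hag⟩ | ⟨p, hp, rfl⟩
      · exact (hx' a ha).trans (mul_nonpos_of_nonneg_of_nonpos ht hag)
      · rw [Finset.mem_filter, Finset.mem_product] at hp
        rw [inner_sub_left, real_inner_smul_left, real_inner_smul_left]
        nlinarith [mul_le_mul_of_nonneg_left (hx' _ hp.1.2) hp.2.1.le,
          mul_le_mul_of_nonneg_left (hx' _ hp.1.1) (neg_nonneg.mpr hp.2.2.le)]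
    · intro hx
      obtain ⟨t, ht, h⟩ := exists_nonneg_forall_mul_le A (fun a => ⟪a, x⟫_ℝ) (fun a => ⟪a, g⟫_ℝ)
        (fun a ha hag => hx a (by simp [ha, hag]))
        (fun a ha b hb hag hbg => by
          have := hx (⟪a, g⟫_ℝ • b - ⟪b, g⟫_ℝ • a) (by
            rw [Finset.mem_union]
            exact Or.inr (Finset.mem_image_of_mem
              (fun p : V × V => ⟪p.1, g⟫_ℝ • p.2 - ⟪p.2, g⟫_ℝ • p.1)
              (Finset.mem_filter.mpr ⟨Finset.mk_mem_product ha hb, hag, hbg⟩)))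
          rwa [inner_sub_left, real_inner_smul_left, real_inner_smul_left] at this)
      refine ⟨t, ht, (hA _).mpr fun a ha => ?_⟩
      rw [inner_sub_right, inner_smul_right]
      linarith [h a ha]

/-- Minkowski's theorem: a polyhedral cone is finitely generated. -/
theorem exists_finset_forall_inner_iff [FiniteDimensional ℝ V] (s : Finset V) :
    ∃ G : Finset V, ∀ x, (∀ a ∈ s, ⟪a, x⟫_ℝ ≤ 0) ↔ x ∈ PointedCone.hull ℝ (G : Set V) := by
  -- The normals of the cone generated by `s` generate its polar. Weyl's theorem is applied a second
  -- time, to `G`: each normal `b` so obtained lies in the cone of `s`, hence is nonpositive at `x`.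
  obtain ⟨G, hG⟩ := exists_finset_mem_hull_iff s
  have hGs : ∀ g ∈ G, ∀ a ∈ s, ⟪a, g⟫_ℝ ≤ 0 := fun g hg a ha => by
    rw [real_inner_comm]
    exact (hG a).mp (Submodule.subset_span ha) g hg
  refine ⟨G, fun x => ⟨fun hx => ?_, fun hx a ha => ?_⟩⟩
  · obtain ⟨B, hB⟩ := exists_finset_mem_hull_iff G
    rw [hB]
    intro b hb
    have hbs : b ∈ PointedCone.hull ℝ (s : Set V) := by
      rw [hG]
      intro g hg
      rw [real_inner_comm]
      exact (hB g).mp (Submodule.subset_span hg) b hb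
    clear hb
    induction hbs using Submodule.span_induction with
    | mem a ha => exact hx a ha
    | zero => simp
    | add a b _ _ h1 h2 => rw [inner_add_left]; linarith
    | smul c a _ h =>
      rw [show c • a = (c : ℝ) • a from rfl, real_inner_smul_left]
      exact mul_nonpos_of_nonneg_of_nonpos c.2 h
  · induction hx using Submodule.span_induction with
    | mem g hg => exact hGs g hg a ha
    | zero => simp
    | add y z _ _ h1 h2 => rw [inner_add_right]; linarith
    | smul c y _ h =>
      rw [show c • y = (c : ℝ) • y from rfl, inner_smul_right]
      exact mul_nonpos_of_nonneg_of_nonpos c.2 h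

/-- Farkas' alternative for a point of `F × ℝ` and the cone generated by finitely many
`(p k, σ k)` together with the upward direction. -/
theorem farkas_alternative [FiniteDimensional ℝ F] {ι : Type*} [Fintype ι] (p : ι → F) (σ : ι → ℝ)
    (q : F) (M : ℝ) :
    (∃ c : ι → ℝ, (∀ k, 0 ≤ c k) ∧ ∑ k, c k • p k = q ∧ ∑ k, c k * σ k ≤ M) ∨
    ∃ (u : F) (β : ℝ), 0 ≤ β ∧ (∀ k, ⟪u, p k⟫_ℝ ≤ β * σ k) ∧ β * M < ⟪u, q⟫_ℝ := by
  classical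
  let gen : Option ι → WithLp 2 (F × ℝ) := fun o =>
    o.elim (WithLp.toLp 2 (0, 1)) fun k => WithLp.toLp 2 (p k, σ k)
  obtain ⟨A, hA⟩ := exists_finset_mem_hull_iff (Finset.univ.image gen)
  by_cases hq : WithLp.toLp 2 (q, M) ∈
      PointedCone.hull ℝ ((Finset.univ.image gen : Finset _) : Set (WithLp 2 (F × ℝ)))
  · left
    unfold PointedCone.hull at hq
    rw [Finset.coe_image, Finset.coe_univ, Set.image_univ,
      Submodule.mem_span_range_iff_exists_fun] at hq
    obtain ⟨c, hc⟩ := hq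
    have hc' : ∑ o, (c o : ℝ) • gen o = WithLp.toLp 2 (q, M) := hc
    refine ⟨fun k => c (some k), fun k => (c (some k)).2, ?_, ?_⟩
    · have := congrArg (WithLp.fstₗ 2 ℝ F ℝ) hc'
      rw [map_sum, Fintype.sum_option] at this
      simpa [gen] using this
    · have := congrArg (WithLp.sndₗ 2 ℝ F ℝ) hc'
      rw [map_sum, Fintype.sum_option] at this
      have h0 : (0 : ℝ) ≤ c none := (c none).2
      have h2 : (c none : ℝ) + ∑ k, (c (some k) : ℝ) * σ k = M := by
        rw [← mul_one (c none : ℝ)]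
        exact this
      linarith
  · right
    rw [hA] at hq
    push Not at hq
    obtain ⟨a, ha, hlt⟩ := hq
    have hgen : ∀ o, ⟪a, gen o⟫_ℝ ≤ 0 := fun o =>
      (hA _).mp (Submodule.subset_span (by simp)) a ha
    have h0 := hgen none
    simp only [gen, Option.elim, WithLp.prod_inner_apply] at h0
    rw [WithLp.prod_inner_apply] at hlt
    refine ⟨a.fst, -a.snd, ?_, fun k => ?_, ?_⟩
    · simpa using h0
    · have := hgen (some k)
      simp only [gen, Option.elim, WithLp.prod_inner_apply] at this
      simp at this
      nlinarith
    · simp at hlt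
      nlinarith

/-- The polyhedron `{u | ⟪u, p k⟫ ≤ σ k for all k}`. -/
def polyhedron {ι : Type*} (p : ι → F) (σ : ι → ℝ) : Set F := {u | ∀ k, ⟪u, p k⟫_ℝ ≤ σ k}

variable [FiniteDimensional ℝ F] {ι : Type*} [Fintype ι] {p : ι → F} {σ : ι → ℝ}

/-- The affine form of Farkas' lemma. -/
theorem exists_certificate_of_bound {q : F} {M : ℝ} (hne : (polyhedron p σ).Nonempty)
    (hM : ∀ u ∈ polyhedron p σ, ⟪u, q⟫_ℝ ≤ M) :
    ∃ c : ι → ℝ, (∀ k, 0 ≤ c k) ∧ ∑ k, c k • p k = q ∧ ∑ k, c k * σ k ≤ M := by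
  rcases farkas_alternative p σ q M with h | ⟨u, β, hβ, hu, hlt⟩
  · exact h
  · exfalso
    -- If `β = 0`, then `u` is a recession direction along which `⟪·, q⟫` is unbounded; otherwise
    -- `β⁻¹ • u` is a feasible point with value above `M`.
    rcases hβ.eq_or_lt with rfl | hβ
    · obtain ⟨l, hl⟩ := hne
      have hpos : 0 < ⟪u, q⟫_ℝ := by simpa using hlt
      obtain ⟨N, hN⟩ := exists_nat_gt ((M - ⟪l, q⟫_ℝ) / ⟪u, q⟫_ℝ)
      rw [div_lt_iff₀ hpos] at hN
      have := hM (l + (N : ℝ) • u) fun k => by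
        rw [inner_add_left, real_inner_smul_left]
        have h1 := hu k
        have h2 := hl k
        have h3 : (N : ℝ) * ⟪u, p k⟫_ℝ ≤ 0 :=
          mul_nonpos_of_nonneg_of_nonpos N.cast_nonneg (by simpa using h1)
        linarith
      rw [inner_add_left, real_inner_smul_left] at this
      linarith
    · have := hM (β⁻¹ • u) fun k => by
        rw [real_inner_smul_left, inv_mul_le_iff₀ hβ]
        exact hu k
      rw [real_inner_smul_left, inv_mul_le_iff₀ hβ] at this
      linarith

/-- Farkas' lemma for the feasibility of a system of linear inequalities. -/
theorem exists_certificate_of_empty (he : polyhedron p σ = ∅) :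
    ∃ c : ι → ℝ, (∀ k, 0 ≤ c k) ∧ ∑ k, c k • p k = 0 ∧ ∑ k, c k * σ k < 0 := by
  rcases farkas_alternative p σ 0 (-1) with ⟨c, h0, h1, h2⟩ | ⟨u, β, hβ, hu, hlt⟩
  · exact ⟨c, h0, h1, by linarith⟩
  · exfalso
    have hβ : 0 < β := by
      rw [inner_zero_right] at hlt
      linarith
    have : β⁻¹ • u ∈ polyhedron p σ := fun k => by
      rw [real_inner_smul_left, inv_mul_le_iff₀ hβ]
      exact hu k
    rw [he] at this
    exact this

/-- A linear function bounded above on a nonempty polyhedron attains its maximum. -/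
theorem exists_isMaxOn_polyhedron {q : F} (hne : (polyhedron p σ).Nonempty)
    (hb : BddAbove ((fun u => ⟪u, q⟫_ℝ) '' polyhedron p σ)) :
    ∃ u ∈ polyhedron p σ, IsMaxOn (fun u => ⟪u, q⟫_ℝ) (polyhedron p σ) u := by
  set S := sSup ((fun u => ⟪u, q⟫_ℝ) '' polyhedron p σ) with hS
  have hle : ∀ u ∈ polyhedron p σ, ⟪u, q⟫_ℝ ≤ S := fun u hu =>
    le_csSup hb (Set.mem_image_of_mem _ hu)
  -- The constraint `⟪u, q⟫ ≥ S` is added. A certificate of infeasibility would contradict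
  -- feasibility of the original system if its new coefficient vanished, and would bound the
  -- objective strictly below `S` if not.
  let p' : Option ι → F := fun o => o.elim (-q) p
  let σ' : Option ι → ℝ := fun o => o.elim (-S) σ
  by_cases he : polyhedron p' σ' = ∅
  · exfalso
    obtain ⟨c, hc, hp, hσ⟩ := exists_certificate_of_empty he
    rw [Fintype.sum_option] at hp hσ
    simp only [p', σ', Option.elim] at hp hσ
    have hp' : ∑ k, c (some k) • p k = c none • q := by
      rw [smul_neg, neg_add_eq_zero] at hp
      exact hp.symm
    have hbound : ∀ u ∈ polyhedron p σ, c none * ⟪u, q⟫_ℝ ≤ ∑ k, c (some k) * σ k := by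
      intro u hu
      rw [← inner_smul_right, ← hp', inner_sum]
      refine Finset.sum_le_sum fun k _ => ?_
      rw [inner_smul_right]
      exact mul_le_mul_of_nonneg_left (hu k) (hc _)
    rcases (hc none).eq_or_lt with h0 | h0
    · obtain ⟨u, hu⟩ := hne
      have := hbound u hu
      rw [← h0] at this hσ
      linarith
    · have : S ≤ (∑ k, c (some k) * σ k) / c none :=
        csSup_le (hne.image _) (by
          rintro _ ⟨u, hu, rfl⟩
          rw [le_div_iff₀ h0]
          linarith [hbound u hu])
      rw [le_div_iff₀ h0] at this
      linarith
  · obtain ⟨u, hu⟩ := Set.nonempty_iff_ne_empty.mpr he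
    refine ⟨u, fun k => hu (some k), fun w hw => ?_⟩
    have h1 := hu none
    simp only [p', σ', Option.elim, inner_neg_right] at h1
    have h2 := hle w hw
    change ⟪w, q⟫_ℝ ≤ ⟪u, q⟫_ℝ
    linarith

variable (p σ) in
/-- Linear functions bounded above on a nonempty polyhedron have maximizers in a ball whose radius
does not depend on the function, with optimal dual solutions. -/
theorem exists_radius_isMaxOn_polyhedron (hne : (polyhedron p σ).Nonempty) :
    ∃ R : ℝ, 0 < R ∧ ∀ q : F, BddAbove ((fun u => ⟪u, q⟫_ℝ) '' polyhedron p σ) →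
      ∃ u ∈ polyhedron p σ, ‖u‖ ≤ R ∧ IsMaxOn (fun u => ⟪u, q⟫_ℝ) (polyhedron p σ) u ∧
        ∃ c : ι → ℝ, (∀ k, 0 ≤ c k) ∧ ∑ k, c k • p k = q ∧ ∑ k, c k * σ k ≤ ⟪u, q⟫_ℝ := by
  classical
  let face : Finset ι → Set F := fun S => {u ∈ polyhedron p σ | ∀ k ∈ S, ⟪u, p k⟫_ℝ = σ k}
  have hpt : ∀ S, ∃ u, (face S).Nonempty → u ∈ face S := fun S => by
    by_cases h : (face S).Nonempty
    · exact ⟨h.some, fun _ => h.some_mem⟩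
    · exact ⟨0, fun h' => absurd h' h⟩
  choose pt hpt using hpt
  refine ⟨1 + ∑ S, ‖pt S‖, by positivity, fun q hb => ?_⟩
  obtain ⟨u, hu, hmax⟩ := exists_isMaxOn_polyhedron hne hb
  obtain ⟨c, hc, hq, hσ⟩ := exists_certificate_of_bound hne (fun w hw => hmax hw)
  have hval : ∀ w, ⟪w, q⟫_ℝ = ∑ k, c k * ⟪w, p k⟫_ℝ := fun w => by
    rw [← hq, inner_sum]
    simp only [inner_smul_right]
  have hcs : ∀ k, c k * ⟪u, p k⟫_ℝ = c k * σ k := by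
    have hle : ∀ k ∈ Finset.univ, c k * ⟪u, p k⟫_ℝ ≤ c k * σ k := fun k _ =>
      mul_le_mul_of_nonneg_left (hu k) (hc k)
    have := (Finset.sum_eq_sum_iff_of_le hle).mp
      (le_antisymm (Finset.sum_le_sum hle) (by rw [← hval]; exact hσ))
    exact fun k => this k (Finset.mem_univ k)
  -- Complementary slackness: every point of the face where the constraints in the support of `c`
  -- are tight is a maximizer, so the point selected in advance for that face serves.
  let S : Finset ι := Finset.univ.filter fun k => c k ≠ 0
  have hS : pt S ∈ face S := hpt S ⟨u, hu, fun k hk =>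
    mul_left_cancel₀ (Finset.mem_filter.mp hk).2 (hcs k)⟩
  have heq : ⟪pt S, q⟫_ℝ = ⟪u, q⟫_ℝ := by
    rw [hval, hval u]
    refine Finset.sum_congr rfl fun k _ => ?_
    by_cases hk : c k = 0
    · rw [hk, zero_mul, zero_mul]
    · rw [hcs, hS.2 k (by simp [S, hk])]
  refine ⟨pt S, hS.1, ?_, fun w hw => ?_, c, hc, hq, by rw [heq]; exact hσ⟩
  · have := Finset.single_le_sum (f := fun S => ‖pt S‖) (fun S _ => norm_nonneg _)
      (Finset.mem_univ S)
    linarith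
  · change ⟪w, q⟫_ℝ ≤ ⟪pt S, q⟫_ℝ
    rw [heq]
    exact hmax hw

end Polyhedral

/-! ### Subgradients of convex functions -/

section ConvexFunctions

theorem coe_toReal_of_mem_dom {F : Type*} {θ : F → EReal} (hbot : ∀ y, θ y ≠ ⊥) {y : F}
    (hy : y ∈ dom θ) : ((θ y).toReal : EReal) = θ y :=
  EReal.coe_toReal (ne_of_lt hy) (hbot y)

variable {F : Type*} [NormedAddCommGroup F] [InnerProductSpace ℝ F] {θ : F → EReal} {y₀ : F}

theorem convexOn_toReal (hc : Convex ℝ (epi θ)) (hbot : ∀ y, θ y ≠ ⊥) :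
    ConvexOn ℝ (dom θ) fun y => (θ y).toReal := by
  have key : ∀ y ∈ dom θ, ∀ z ∈ dom θ, ∀ a b : ℝ, 0 ≤ a → 0 ≤ b → a + b = 1 →
      θ (a • y + b • z) ≤ ((a * (θ y).toReal + b * (θ z).toReal : ℝ) : EReal) := by
    intro y hy z hz a b ha hb hab
    have h1 : WithLp.toLp 2 (y, (θ y).toReal) ∈ epi θ := (coe_toReal_of_mem_dom hbot hy).ge
    have h2 : WithLp.toLp 2 (z, (θ z).toReal) ∈ epi θ := (coe_toReal_of_mem_dom hbot hz).ge
    exact hc h1 h2 ha hb hab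
  refine ⟨fun y hy z hz a b ha hb hab =>
    (key y hy z hz a b ha hb hab).trans_lt (EReal.coe_lt_top _),
    fun y hy z hz a b ha hb hab => ?_⟩
  have h := key y hy z hz a b ha hb hab
  have hm : a • y + b • z ∈ dom θ := h.trans_lt (EReal.coe_lt_top _)
  rw [← coe_toReal_of_mem_dom hbot hm, EReal.coe_le_coe_iff] at h
  exact h

/-- Along the segment from `y` to `z` both sides of the defining inequality scale with `t`, so the
asymptotic estimate holds at `z` itself, for every `ε`. -/
theorem inner_le_zero_of_mem_regularNormalCone {Ω : Set F} (hΩ : Convex ℝ Ω) {y u : F}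
    (hy : y ∈ Ω) (hu : u ∈ regularNormalCone Ω y) {z : F} (hz : z ∈ Ω) : ⟪u, z - y⟫_ℝ ≤ 0 := by
  have hε : ∀ ε : ℝ, 0 < ε → ⟪u, z - y⟫_ℝ ≤ ε * ‖z - y‖ := by
    intro ε hε
    have ht : Tendsto (fun t : ℝ => y + t • (z - y)) (𝓝[>] 0) (𝓝[Ω] y) := by
      refine tendsto_nhdsWithin_iff.mpr ⟨?_, ?_⟩
      · have : Continuous fun t : ℝ => y + t • (z - y) := by fun_prop
        simpa using (this.tendsto 0).mono_left nhdsWithin_le_nhds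
      · filter_upwards [Ioo_mem_nhdsGT (zero_lt_one' ℝ)] with t ht
        exact hΩ.add_smul_sub_mem hy hz ⟨ht.1.le, ht.2.le⟩
    obtain ⟨t, h, ht⟩ := ((ht.eventually (hu ε hε)).and self_mem_nhdsWithin).exists
    have ht : 0 < t := ht
    rw [add_sub_cancel_left, inner_smul_right, norm_smul, Real.norm_of_nonneg ht.le] at h
    nlinarith
  refine le_of_forall_pos_le_add fun ε hpos => ?_
  have := hε (ε / (‖z - y‖ + 1)) (by positivity)
  have h2 : ε / (‖z - y‖ + 1) * ‖z - y‖ ≤ ε := by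
    rw [div_mul_eq_mul_div, div_le_iff₀ (by positivity)]
    nlinarith [norm_nonneg (z - y)]
  linarith

/-- For convex functions limiting subgradients are subgradients of convex analysis. -/
theorem mem_subdifferential_iff (hc : Convex ℝ (epi θ)) (hbot : ∀ y, θ y ≠ ⊥)
    (hy₀ : y₀ ∈ dom θ) {l : F} :
    l ∈ subdifferential θ y₀ ↔
      ∀ y ∈ dom θ, (θ y₀).toReal + ⟪l, y - y₀⟫_ℝ ≤ (θ y).toReal := by
  constructor
  · rintro ⟨y, u, hy, hty, htu, hN⟩ z hz
    have hz' : WithLp.toLp 2 (z, (θ z).toReal) ∈ epi θ := (coe_toReal_of_mem_dom hbot hz).ge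
    have hlim := htu.inner (𝕜 := ℝ) ((tendsto_const_nhds (x := WithLp.toLp 2 (z, (θ z).toReal))).sub
      hty)
    have := le_of_tendsto hlim (Eventually.of_forall fun k =>
      inner_le_zero_of_mem_regularNormalCone hc (hy k) (hN k) hz')
    rw [WithLp.prod_inner_apply] at this
    simp at this
    linarith
  · intro h
    refine ⟨fun _ => WithLp.toLp 2 (y₀, (θ y₀).toReal), fun _ => WithLp.toLp 2 (l, -1),
      fun _ => (coe_toReal_of_mem_dom hbot hy₀).ge, tendsto_const_nhds, tendsto_const_nhds,
      fun _ ε hε => ?_⟩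
    filter_upwards [self_mem_nhdsWithin] with p hp
    have hp : θ p.fst ≤ (p.snd : EReal) := hp
    have hpd : p.fst ∈ dom θ := hp.trans_lt (EReal.coe_lt_top _)
    rw [← coe_toReal_of_mem_dom hbot hpd, EReal.coe_le_coe_iff] at hp
    have h1 := h p.fst hpd
    have h2 : ⟪WithLp.toLp 2 (l, (-1 : ℝ)), p - WithLp.toLp 2 (y₀, (θ y₀).toReal)⟫_ℝ =
        ⟪l, p.fst - y₀⟫_ℝ - (p.snd - (θ y₀).toReal) := by
      rw [WithLp.prod_inner_apply]
      simp
      ring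
    rw [h2]
    have : 0 ≤ ε * ‖p - WithLp.toLp 2 (y₀, (θ y₀).toReal)‖ := by positivity
    linarith

end ConvexFunctions

/-! ### Limits and bounds for difference quotients -/

section ScaledDirections

variable {E : Type*} [NormedAddCommGroup E]

theorem eventually_fst_pos (w : E) : ∀ᶠ p : ℝ × E in 𝓝[>] (0 : ℝ) ×ˢ 𝓝 w, 0 < p.1 :=
  have h : ∀ᶠ t in 𝓝[>] (0 : ℝ), 0 < t := self_mem_nhdsWithin
  h.prod_inl _

theorem tendsto_fst_zero (w : E) :
    Tendsto (fun p : ℝ × E => p.1) (𝓝[>] (0 : ℝ) ×ˢ 𝓝 w) (𝓝 0) :=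
  tendsto_fst.mono_right nhdsWithin_le_nhds

variable [NormedSpace ℝ E]

theorem tendsto_add_smul (x w : E) :
    Tendsto (fun p : ℝ × E => x + p.1 • p.2) (𝓝[>] (0 : ℝ) ×ˢ 𝓝 w) (𝓝 x) := by
  simpa using tendsto_const_nhds.add ((tendsto_fst_zero w).smul tendsto_snd)

end ScaledDirections

section Quotients

variable {E : Type*} [NormedAddCommGroup E] [InnerProductSpace ℝ E] {φ : E → EReal} {x v w : E}

theorem secondQuotient_of_eq_coe {a b t : ℝ} {u : E} (ha : φ x = a) (hb : φ (x + t • u) = b) :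
    secondQuotient φ x v t u = ((b - a - t * ⟪v, u⟫_ℝ) / (1 / 2 * t ^ 2) : ℝ) := by
  rw [secondQuotient, ha, hb, ← EReal.coe_sub, ← EReal.coe_sub, ← EReal.coe_div]

theorem secondQuotient_of_eq_top {a t : ℝ} {u : E} (ht : 0 < t) (ha : φ x = a)
    (hb : φ (x + t • u) = ⊤) : secondQuotient φ x v t u = ⊤ := by
  rw [secondQuotient, ha, hb, EReal.top_sub_coe, EReal.top_sub_coe]
  exact EReal.top_div_of_pos_ne_top (by exact_mod_cast (by positivity)) (EReal.coe_ne_top _)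

/-- The second subderivative is bounded above along recovery curves. -/
theorem secondSubderivative_le_of_tendsto {γ : ℝ → E} {B : ℝ → ℝ} {b : ℝ}
    (hγ : Tendsto γ (𝓝[>] 0) (𝓝 w)) (hB : Tendsto B (𝓝[>] 0) (𝓝 b))
    (h : ∀ᶠ t in 𝓝[>] (0 : ℝ), secondQuotient φ x v t (γ t) ≤ (B t : EReal)) :
    secondSubderivative φ x v w ≤ b := by
  have hlim : Tendsto (fun t => (B t : EReal)) (𝓝[>] 0) (𝓝 (b : EReal)) :=
    (continuous_coe_real_ereal.tendsto b).comp hB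
  have htend : Tendsto (fun t => (t, γ t)) (𝓝[>] (0 : ℝ)) (𝓝[>] (0 : ℝ) ×ˢ 𝓝 w) :=
    tendsto_id.prodMk hγ
  rw [← hlim.liminf_eq]
  refine (liminf_le_liminf_of_le htend).trans ?_
  rw [← liminf_comp]
  exact liminf_le_liminf h

theorem le_secondSubderivative {M : EReal}
    (h : ∀ᶠ p : ℝ × E in 𝓝[>] (0 : ℝ) ×ˢ 𝓝 w, M ≤ secondQuotient φ x v p.1 p.2) :
    M ≤ secondSubderivative φ x v w :=
  le_liminf_of_le (by isBoundedDefault) h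

end Quotients

/-! ### Lipschitz estimates across finitely many closed pieces -/

section ClosedCover

variable {F : Type*} [NormedAddCommGroup F] [InnerProductSpace ℝ F]

/-- A pigeonhole principle, used to find one piece that a segment meets arbitrarily close to a given
parameter. -/
theorem exists_frequently_of_eventually_exists {α ι : Type*} [Finite ι] {l : Filter α} [NeBot l]
    {P : ι → α → Prop} (h : ∀ᶠ a in l, ∃ i, P i a) : ∃ i, ∃ᶠ a in l, P i a := by
  by_contra hc
  push Not at hc
  obtain ⟨a, h1, i, h2⟩ := ((eventually_all.mpr hc).and h).exists
  exact h1 i h2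

/-- A function that is Lipschitz on each of finitely many closed sets covering a segment is
Lipschitz along the segment. -/
theorem sub_le_of_finite_closed_cover {ι : Type*} [Finite ι] {Ω : ι → Set F} {Q : ι → F → ℝ}
    {g : F → ℝ} {y z : F} {ℓ : ℝ} (hΩ : ∀ i, IsClosed (Ω i)) (hQ : ∀ i, Continuous (Q i))
    (hg : ∀ i, ∀ u ∈ Ω i, g u = Q i u) (hcov : segment ℝ y z ⊆ ⋃ i, Ω i)
    (hlip : ∀ i, ∀ u ∈ segment ℝ y z, ∀ u' ∈ segment ℝ y z, Q i u' - Q i u ≤ ℓ * ‖u' - u‖) :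
    g z - g y ≤ ℓ * ‖z - y‖ := by
  let γ : ℝ → F := fun s => y + s • (z - y)
  have hγc : Continuous γ := by fun_prop
  have hseg : ∀ s ∈ Set.Icc (0 : ℝ) 1, γ s ∈ segment ℝ y z := fun s hs => by
    rw [segment_eq_image']
    exact ⟨s, hs, rfl⟩
  have hγ0 : γ 0 = y := by simp [γ]
  have hγ1 : γ 1 = z := by simp [γ]
  let G : Set ℝ := {s | g (γ s) ≤ g y + ℓ * (s * ‖z - y‖)}
  -- Continuous induction. Continuity of `g` is not assumed: closedness comes from the continuous `Q
  -- i` on closed pieces. To move right from `s`, a piece accumulating at `s` from the right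
  -- contains `γ s` too, so a single `Q i` compares `s` with some `r > s`.
  have hG : Set.Icc (0 : ℝ) 1 ⊆ G := by
    refine IsClosed.Icc_subset_of_forall_exists_gt ?_ ?_ ?_
    · have : G ∩ Set.Icc 0 1 = ⋃ i, ({s | s ∈ γ ⁻¹' Ω i ∧
          Q i (γ s) ≤ g y + ℓ * (s * ‖z - y‖)} ∩ Set.Icc 0 1) := by
        ext s
        simp only [Set.mem_inter_iff, Set.mem_iUnion]
        constructor
        · rintro ⟨h1, h2⟩
          obtain ⟨i, hi⟩ := Set.mem_iUnion.mp (hcov (hseg s h2))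
          refine ⟨i, ⟨hi, ?_⟩, h2⟩
          rw [← hg i _ hi]
          exact h1
        · rintro ⟨i, ⟨hi, h1⟩, h2⟩
          refine ⟨?_, h2⟩
          change g (γ s) ≤ _
          rw [hg i _ hi]
          exact h1
      rw [this]
      refine isClosed_iUnion_of_finite fun i => IsClosed.inter ?_ isClosed_Icc
      exact ((hΩ i).preimage hγc).inter
        (isClosed_le ((hQ i).comp hγc) (by fun_prop))
    · simp [G, hγ0]
    · rintro s ⟨hsG, hs⟩ b hb
      have hs1 : s < min b 1 := lt_min hb hs.2
      have hev : ∀ᶠ r in 𝓝[>] s, ∃ i, γ r ∈ Ω i := by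
        filter_upwards [Ioo_mem_nhdsGT hs1] with r hr
        exact Set.mem_iUnion.mp (hcov (hseg r ⟨hs.1.trans hr.1.le,
          (hr.2.trans_le (min_le_right _ _)).le⟩))
      obtain ⟨i, hi⟩ := exists_frequently_of_eventually_exists hev
      have hsi : γ s ∈ Ω i := by
        have : s ∈ closure (γ ⁻¹' Ω i) :=
          mem_closure_iff_frequently.mpr (hi.filter_mono nhdsWithin_le_nhds)
        rwa [((hΩ i).preimage hγc).closure_eq] at this
      obtain ⟨r, hri, hr⟩ := (hi.and_eventually (Ioo_mem_nhdsGT hs1)).exists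
      have hr1 : r < 1 := hr.2.trans_le (min_le_right _ _)
      refine ⟨r, ?_, hr.1, (hr.2.trans_le (min_le_left _ _)).le⟩
      have h1 := hlip i _ (hseg s ⟨hs.1, hs.2.le⟩) _ (hseg r ⟨hs.1.trans hr.1.le, hr1.le⟩)
      have h2 : γ r - γ s = (r - s) • (z - y) := by
        simp only [γ]; module
      rw [h2, norm_smul, Real.norm_of_nonneg (by linarith [hr.1]), ← hg i _ hri, ← hg i _ hsi] at h1
      have h3 : g (γ s) ≤ g y + ℓ * (s * ‖z - y‖) := hsG
      change g (γ r) ≤ g y + ℓ * (r * ‖z - y‖)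
      linarith
  have := hG (Set.right_mem_Icc.mpr zero_le_one)
  change g (γ 1) ≤ _ at this
  rw [hγ1] at this
  linarith

end ClosedCover

/-! ### Local conic structure of piecewise linear-quadratic functions -/

section Germ

variable {F : Type*} [NormedAddCommGroup F] [InnerProductSpace ℝ F]

/-- The cone `{w | ⟪a, w⟫ ≤ 0 for all a ∈ s}`. -/
def polarCone (s : Finset F) : Set F := {w | ∀ a ∈ s, ⟪a, w⟫_ℝ ≤ 0}

theorem isClosed_polarCone (s : Finset F) : IsClosed (polarCone s) := by
  have : polarCone s = ⋂ a ∈ s, {w | ⟪a, w⟫_ℝ ≤ 0} := by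
    ext w
    simp [polarCone]
  rw [this]
  exact isClosed_biInter fun a _ => isClosed_le (by fun_prop) continuous_const

theorem smul_mem_polarCone_iff {s : Finset F} {t : ℝ} (ht : 0 < t) {w : F} :
    t • w ∈ polarCone s ↔ w ∈ polarCone s := by
  refine forall₂_congr fun a _ => ?_
  rw [inner_smul_right, mul_nonpos_iff_pos_imp_nonpos]
  simp only [ht, true_implies, ht.le, implies_true, and_true]

/-- The local structure of a convex piecewise linear-quadratic function at a point `y₀` of its
domain `D`: near `y₀` the points of `D` lie in finitely many translated polyhedral cones, on each
of which the function is quadratic. -/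
structure PLQGerm (D : Set F) (g : F → ℝ) (y₀ : F) where
  /-- The index type of the pieces. -/
  ι : Type
  [fintype : Fintype ι]
  /-- The outer normals of the tangent cone of a piece. -/
  normals : ι → Finset F
  /-- The Hessian of a piece. -/
  A : ι → F →L[ℝ] F
  /-- The gradient at `y₀` of a piece. -/
  c : ι → F
  eventually_exists : ∀ᶠ y in 𝓝 y₀, y ∈ D → ∃ i, y - y₀ ∈ polarCone (normals i) ∧
    g y = g y₀ + ⟪c i, y - y₀⟫_ℝ + 1 / 2 * ⟪A i (y - y₀), y - y₀⟫_ℝ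
  eventually_mem : ∀ i, ∀ w ∈ polarCone (normals i), ∀ᶠ t in 𝓝[>] (0 : ℝ), y₀ + t • w ∈ D ∧
    g (y₀ + t • w) = g y₀ + t * ⟪c i, w⟫_ℝ + 1 / 2 * t ^ 2 * ⟪A i w, w⟫_ℝ
  convexOn : ConvexOn ℝ D g
  mem : y₀ ∈ D
  lipschitz : ∃ ℓ : ℝ, 0 ≤ ℓ ∧ ∀ y ∈ D ∩ Metric.ball y₀ 1, ∀ z ∈ D ∩ Metric.ball y₀ 1,
    g z ≤ g y + ℓ * ‖z - y‖

attribute [instance] PLQGerm.fintype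

theorem quadratic_sub {A : F →L[ℝ] F} (hA : (A : F →ₗ[ℝ] F).IsSymmetric) (a : F) (α : ℝ)
    (y z : F) :
    (1 / 2 * ⟪A z, z⟫_ℝ + ⟪a, z⟫_ℝ + α) - (1 / 2 * ⟪A y, y⟫_ℝ + ⟪a, y⟫_ℝ + α) =
      ⟪A y + a, z - y⟫_ℝ + 1 / 2 * ⟪A (z - y), z - y⟫_ℝ := by
  have h1 : ⟪A z, y⟫_ℝ = ⟪A y, z⟫_ℝ := by
    rw [real_inner_comm]
    exact (hA y z).symm
  simp only [map_sub, inner_sub_left, inner_sub_right, inner_add_left, h1]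
  ring

/-- The gradient at `y` contributes `‖A‖ * (‖y₀‖ + 1) + ‖a‖`; the quadratic term contributes one
more `‖A‖`, since `‖z - y‖ ≤ 2` in the ball. -/
theorem quadratic_sub_le {A : F →L[ℝ] F} (hA : (A : F →ₗ[ℝ] F).IsSymmetric) (a : F) (α : ℝ)
    {y₀ y z : F} (hy : y ∈ Metric.ball y₀ 1) (hz : z ∈ Metric.ball y₀ 1) :
    (1 / 2 * ⟪A z, z⟫_ℝ + ⟪a, z⟫_ℝ + α) - (1 / 2 * ⟪A y, y⟫_ℝ + ⟪a, y⟫_ℝ + α) ≤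
      (‖A‖ * (‖y₀‖ + 2) + ‖a‖) * ‖z - y‖ := by
  rw [quadratic_sub hA]
  have h1 : ‖A y + a‖ ≤ ‖A‖ * (‖y₀‖ + 1) + ‖a‖ := by
    refine (norm_add_le _ _).trans (add_le_add_left ((A.le_opNorm y).trans ?_) _)
    refine mul_le_mul_of_nonneg_left ?_ (norm_nonneg _)
    have := norm_sub_norm_le y y₀
    rw [Metric.mem_ball, dist_eq_norm] at hy
    linarith
  have h2 : ‖z - y‖ ≤ 2 := by
    rw [← dist_eq_norm]
    have := dist_triangle_right z y y₀
    rw [Metric.mem_ball] at hy hz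
    linarith
  have h3 := real_inner_le_norm (A y + a) (z - y)
  have h4 : ⟪A (z - y), z - y⟫_ℝ ≤ ‖A‖ * ‖z - y‖ * ‖z - y‖ :=
    (real_inner_le_norm _ _).trans
      (mul_le_mul_of_nonneg_right (A.le_opNorm _) (norm_nonneg _))
  have h5 : ‖A y + a‖ * ‖z - y‖ ≤ (‖A‖ * (‖y₀‖ + 1) + ‖a‖) * ‖z - y‖ :=
    mul_le_mul_of_nonneg_right h1 (norm_nonneg _)
  have h6 : ‖A‖ * ‖z - y‖ * ‖z - y‖ ≤ ‖A‖ * 2 * ‖z - y‖ := by gcongr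
  linarith

theorem IsPolyhedralConvex.isClosed {P : Set F} (hP : IsPolyhedralConvex P) : IsClosed P := by
  obtain ⟨k, a, b, rfl⟩ := hP
  have : {x | ∀ j, ⟪a j, x⟫_ℝ ≤ b j} = ⋂ j, {x | ⟪a j, x⟫_ℝ ≤ b j} := by
    ext
    simp
  rw [this]
  exact isClosed_iInter fun j => isClosed_le (by fun_prop) continuous_const

/-- The tangent cone of a polyhedral convex set. -/
theorem IsPolyhedralConvex.exists_polarCone {P : Set F} (hP : IsPolyhedralConvex P) {y₀ : F}
    (hy₀ : y₀ ∈ P) :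
    ∃ s : Finset F, (∀ y ∈ P, y - y₀ ∈ polarCone s) ∧
      ∀ w ∈ polarCone s, ∀ᶠ t in 𝓝[>] (0 : ℝ), y₀ + t • w ∈ P := by
  classical
  obtain ⟨k, a, b, rfl⟩ := hP
  -- Only constraints active at `y₀` matter; the inactive ones persist for small `t` by continuity.
  refine ⟨(Finset.univ.filter fun j => ⟪a j, y₀⟫_ℝ = b j).image a, fun y hy c hc => ?_,
    fun w hw => eventually_all.mpr fun j => ?_⟩
  · obtain ⟨j, hj, rfl⟩ := Finset.mem_image.mp hc
    have := hy j
    rw [inner_sub_right, (Finset.mem_filter.mp hj).2]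
    linarith
  · rcases (hy₀ j).eq_or_lt with h | h
    · filter_upwards [self_mem_nhdsWithin] with t ht
      have := hw (a j) (Finset.mem_image_of_mem a (by simpa using h))
      rw [inner_add_right, inner_smul_right, h]
      have ht : 0 < t := ht
      nlinarith
    · have hc : Continuous fun t : ℝ => ⟪a j, y₀ + t • w⟫_ℝ := by fun_prop
      have := (hc.tendsto 0).eventually_lt_const (u := b j) (by simpa using h)
      exact (this.filter_mono nhdsWithin_le_nhds).mono fun t ht => le_of_lt ht

variable {θ : F → EReal} {y₀ : F}

theorem IsPWLQ.ne_bot (h : IsPWLQ θ) (y : F) : θ y ≠ ⊥ := by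
  obtain ⟨s, Ω, A, a, α, -, -, hdom, hval⟩ := h
  by_cases hy : y ∈ dom θ
  · rw [hdom] at hy
    obtain ⟨i, hi⟩ := Set.mem_iUnion.mp hy
    rw [hval i y hi]
    exact EReal.coe_ne_bot _
  · intro hb
    exact hy (by simp [dom, hb])

/-- Convex piecewise linear-quadratic functions have germs. -/
theorem IsPWLQ.nonempty_germ [FiniteDimensional ℝ F] (h : IsPWLQ θ) (hc : Convex ℝ (epi θ))
    (hy₀ : y₀ ∈ dom θ) : Nonempty (PLQGerm (dom θ) (fun y => (θ y).toReal) y₀) := by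
  classical
  have hconv := convexOn_toReal hc h.ne_bot
  obtain ⟨s, Ω, A, a, α, hΩ, hA, hdom, hval⟩ := h
  let A' : Fin s → F →L[ℝ] F := fun i => (A i).toContinuousLinearMap
  let Q : Fin s → F → ℝ := fun i y => 1 / 2 * ⟪A' i y, y⟫_ℝ + ⟪a i, y⟫_ℝ + α i
  have hQ : ∀ i, ∀ y ∈ Ω i, (θ y).toReal = Q i y := fun i y hy => by
    rw [hval i y hy, EReal.toReal_coe]
    rfl
  have hA' : ∀ i, (A' i : F →ₗ[ℝ] F).IsSymmetric := fun i => by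
    simpa [A'] using hA i
  choose! S hS1 hS2 using fun i (hi : y₀ ∈ Ω i) => (hΩ i).exists_polarCone hi
  -- Only the pieces through `y₀` are kept: the others are closed, hence avoid a neighborhood of
  -- `y₀`.
  refine ⟨{
    ι := {i : Fin s // y₀ ∈ Ω i}
    normals := fun i => S i
    A := fun i => A' i
    c := fun i => A' i y₀ + a i
    eventually_exists := ?_
    eventually_mem := ?_
    convexOn := hconv
    mem := hy₀
    lipschitz := ?_ }⟩
  · have hev : ∀ᶠ y in 𝓝 y₀, ∀ i, y ∈ Ω i → y₀ ∈ Ω i := eventually_all.mpr fun i => by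
      by_cases hi : y₀ ∈ Ω i
      · exact Eventually.of_forall fun _ _ => hi
      · filter_upwards [(hΩ i).isClosed.isOpen_compl.mem_nhds hi] with y hy hy'
        exact absurd hy' hy
    filter_upwards [hev] with y hy hyD
    rw [hdom] at hyD
    obtain ⟨i, hi⟩ := Set.mem_iUnion.mp hyD
    refine ⟨⟨i, hy i hi⟩, hS1 i (hy i hi) y hi, ?_⟩
    have := quadratic_sub (hA' i) (a i) (α i) y₀ y
    simp only [hQ i y hi, hQ i y₀ (hy i hi), Q]
    linarith
  · rintro ⟨i, hi⟩ w hw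
    filter_upwards [hS2 i hi w hw] with t ht
    refine ⟨by rw [hdom]; exact Set.mem_iUnion.mpr ⟨i, ht⟩, ?_⟩
    have := quadratic_sub (hA' i) (a i) (α i) y₀ (y₀ + t • w)
    rw [add_sub_cancel_left, map_smul, inner_smul_right, inner_smul_right,
      real_inner_smul_left] at this
    simp only [hQ i _ ht, hQ i y₀ hi, Q]
    linarith
  · refine ⟨∑ i, (‖A' i‖ * (‖y₀‖ + 2) + ‖a i‖), by positivity, fun y hy z hz => ?_⟩
    have hsegD : segment ℝ y z ⊆ dom θ := hconv.1.segment_subset hy.1 hz.1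
    have hsegB : segment ℝ y z ⊆ Metric.ball y₀ 1 :=
      (convex_ball y₀ 1).segment_subset hy.2 hz.2
    have := sub_le_of_finite_closed_cover (g := fun y => (θ y).toReal) (Q := Q) (y := y) (z := z)
      (ℓ := ∑ i, (‖A' i‖ * (‖y₀‖ + 2) + ‖a i‖)) (fun i => (hΩ i).isClosed)
      (fun i => by fun_prop) hQ (by rw [← hdom]; exact hsegD)
      (fun i u hu u' hu' => by
        refine (quadratic_sub_le (hA' i) (a i) (α i) (hsegB hu) (hsegB hu')).trans ?_
        refine mul_le_mul_of_nonneg_right ?_ (norm_nonneg _)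
        exact Finset.single_le_sum (f := fun i => ‖A' i‖ * (‖y₀‖ + 2) + ‖a i‖)
          (fun i _ => by positivity) (Finset.mem_univ i))
    linarith

end Germ

/-! ### Subgradients, critical directions and growth for germs -/

namespace PLQGerm

variable {F : Type*} [NormedAddCommGroup F] [InnerProductSpace ℝ F] {D : Set F} {g : F → ℝ}
  {y₀ : F} (G : PLQGerm D g y₀)

/-- Subgradients at the base point of a germ. -/
theorem forall_subgradient_iff {l : F} :
    (∀ y ∈ D, g y₀ + ⟪l, y - y₀⟫_ℝ ≤ g y) ↔
      ∀ i, ∀ w ∈ polarCone (G.normals i), ⟪l, w⟫_ℝ ≤ ⟪G.c i, w⟫_ℝ := by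
  constructor
  · intro h i w hw
    have hlim : Tendsto (fun t : ℝ => ⟪G.c i, w⟫_ℝ + 1 / 2 * t * ⟪G.A i w, w⟫_ℝ) (𝓝[>] 0)
        (𝓝 ⟪G.c i, w⟫_ℝ) := by
      have : Continuous fun t : ℝ => ⟪G.c i, w⟫_ℝ + 1 / 2 * t * ⟪G.A i w, w⟫_ℝ := by fun_prop
      simpa using (this.tendsto 0).mono_left nhdsWithin_le_nhds
    refine ge_of_tendsto hlim ?_
    filter_upwards [G.eventually_mem i w hw, self_mem_nhdsWithin] with t ht ht0
    have ht0 : 0 < t := ht0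
    have := h _ ht.1
    rw [ht.2, add_sub_cancel_left, inner_smul_right] at this
    refine le_of_mul_le_mul_left ?_ ht0
    linarith
  · intro h y hy
    -- Convexity bounds the slope of `g` at small `t` by `g y - g y₀`. The piece met at `t` may vary
    -- with `t`, so the curvature is bounded below uniformly over the pieces.
    obtain ⟨M, hM⟩ : ∃ M : ℝ, ∀ i, -M ≤ ⟪G.A i (y - y₀), y - y₀⟫_ℝ := by
      refine ⟨∑ i, |⟪G.A i (y - y₀), y - y₀⟫_ℝ|, fun i => ?_⟩
      have := Finset.single_le_sum (f := fun i => |⟪G.A i (y - y₀), y - y₀⟫_ℝ|)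
        (fun i _ => abs_nonneg _) (Finset.mem_univ i)
      linarith [neg_abs_le ⟪G.A i (y - y₀), y - y₀⟫_ℝ]
    have hc : Tendsto (fun t : ℝ => y₀ + t • (y - y₀)) (𝓝[>] 0) (𝓝 y₀) := by
      have : Continuous fun t : ℝ => y₀ + t • (y - y₀) := by fun_prop
      simpa using (this.tendsto 0).mono_left nhdsWithin_le_nhds
    have hev : ∀ᶠ t in 𝓝[>] (0 : ℝ), ⟪l, y - y₀⟫_ℝ - 1 / 2 * t * M ≤ g y - g y₀ := by
      filter_upwards [hc.eventually G.eventually_exists, Ioo_mem_nhdsGT (zero_lt_one' ℝ)] with t ht ht0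
      have hmem := G.convexOn.1.add_smul_sub_mem G.mem hy ⟨ht0.1.le, ht0.2.le⟩
      obtain ⟨i, hi, hgi⟩ := ht hmem
      rw [add_sub_cancel_left] at hi hgi
      rw [smul_mem_polarCone_iff ht0.1] at hi
      rw [map_smul, inner_smul_right, inner_smul_right, real_inner_smul_left] at hgi
      have hconv := G.convexOn.2 G.mem hy (sub_nonneg.mpr ht0.2.le) ht0.1.le (by ring)
      rw [show (1 - t) • y₀ + t • y = y₀ + t • (y - y₀) by module, hgi] at hconv
      simp only [smul_eq_mul] at hconv
      refine le_of_mul_le_mul_left ?_ ht0.1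
      have h2 := mul_le_mul_of_nonneg_left (h i _ hi) ht0.1.le
      have h3 := mul_le_mul_of_nonneg_left (hM i) (mul_nonneg ht0.1.le ht0.1.le)
      nlinarith
    have hlim : Tendsto (fun t : ℝ => ⟪l, y - y₀⟫_ℝ - 1 / 2 * t * M) (𝓝[>] 0)
        (𝓝 ⟪l, y - y₀⟫_ℝ) := by
      have : Continuous fun t : ℝ => ⟪l, y - y₀⟫_ℝ - 1 / 2 * t * M := by fun_prop
      simpa using (this.tendsto 0).mono_left nhdsWithin_le_nhds
    linarith [le_of_tendsto hlim hev]

/-- The curvature in a direction does not depend on the piece containing it. -/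
theorem inner_A_eq {i j : G.ι} {w : F} (hi : w ∈ polarCone (G.normals i))
    (hj : w ∈ polarCone (G.normals j)) : ⟪G.A i w, w⟫_ℝ = ⟪G.A j w, w⟫_ℝ := by
  have h := (G.eventually_mem i w hi).and (G.eventually_mem j w hj)
  -- Comparing the two expansions at both `t` and `t / 2` eliminates the linear terms.
  have hhalf : Tendsto (fun t : ℝ => t / 2) (𝓝[>] 0) (𝓝[>] 0) := by
    refine tendsto_nhdsWithin_iff.mpr ⟨?_, ?_⟩
    · have : Continuous fun t : ℝ => t / 2 := by fun_prop
      simpa using (this.tendsto 0).mono_left nhdsWithin_le_nhds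
    · filter_upwards [self_mem_nhdsWithin] with t ht
      exact half_pos (Set.mem_Ioi.mp ht)
  obtain ⟨t, ⟨⟨h1, h2⟩, ⟨h3, h4⟩⟩, ht⟩ :=
    ((h.and (hhalf.eventually h)).and self_mem_nhdsWithin).exists
  have ht : 0 < t := ht
  have e1 := h1.2.symm.trans h2.2
  have e2 := h3.2.symm.trans h4.2
  have : t ^ 2 * (⟪G.A i w, w⟫_ℝ - ⟪G.A j w, w⟫_ℝ) = 0 := by nlinarith
  rcases mul_eq_zero.mp this with h | h
  · exact absurd h (by positivity)
  · linarith

/-- A direction `w` is critical for the subgradient `l` if the directional derivative along `w`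
equals `⟪l, w⟫`. -/
def IsCritical (l w : F) : Prop :=
  ∃ i, w ∈ polarCone (G.normals i) ∧ ⟪G.c i, w⟫_ℝ = ⟪l, w⟫_ℝ

theorem eventually_not_mem_polarCone {s : Finset F} {w : F} (hw : w ∉ polarCone s) :
    ∀ᶠ p : ℝ × F in 𝓝[>] (0 : ℝ) ×ˢ 𝓝 w, p.2 ∉ polarCone s :=
  tendsto_snd.eventually ((isClosed_polarCone s).isOpen_compl.mem_nhds hw)

theorem eventually_exists_smul (w : F) :
    ∀ᶠ p : ℝ × F in 𝓝[>] (0 : ℝ) ×ˢ 𝓝 w, y₀ + p.1 • p.2 ∈ D →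
      ∃ i, p.2 ∈ polarCone (G.normals i) ∧ g (y₀ + p.1 • p.2) =
        g y₀ + p.1 * ⟪G.c i, p.2⟫_ℝ + 1 / 2 * p.1 ^ 2 * ⟪G.A i p.2, p.2⟫_ℝ := by
  filter_upwards [(tendsto_add_smul y₀ w).eventually G.eventually_exists, eventually_fst_pos w]
    with p hp ht hD
  obtain ⟨i, hi, hgi⟩ := hp hD
  rw [add_sub_cancel_left] at hi hgi
  rw [smul_mem_polarCone_iff ht] at hi
  rw [map_smul, inner_smul_right, inner_smul_right, real_inner_smul_left] at hgi
  exact ⟨i, hi, by rw [hgi]; ring⟩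

variable {l w : F}

/-- First-order growth in noncritical directions. -/
theorem exists_growth_of_not_isCritical (hl : ∀ y ∈ D, g y₀ + ⟪l, y - y₀⟫_ℝ ≤ g y)
    (hw : ¬ G.IsCritical l w) :
    ∃ ε : ℝ, 0 < ε ∧ ∀ᶠ p : ℝ × F in 𝓝[>] (0 : ℝ) ×ˢ 𝓝 w, y₀ + p.1 • p.2 ∈ D →
      g y₀ + p.1 * ⟪l, p.2⟫_ℝ + p.1 * ε ≤ g (y₀ + p.1 • p.2) := by
  rw [G.forall_subgradient_iff] at hl
  have key : ∀ i, ∃ ε : ℝ, 0 < ε ∧ ∀ᶠ p : ℝ × F in 𝓝[>] (0 : ℝ) ×ˢ 𝓝 w,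
      p.2 ∈ polarCone (G.normals i) →
        ⟪l, p.2⟫_ℝ + ε ≤ ⟪G.c i, p.2⟫_ℝ + 1 / 2 * p.1 * ⟪G.A i p.2, p.2⟫_ℝ := by
    intro i
    -- On a piece containing `w` the slope gap is strict, and half of it survives nearby; a piece
    -- missing `w` misses all nearby directions, as its cone is closed.
    by_cases hi : w ∈ polarCone (G.normals i)
    · have hlt : ⟪l, w⟫_ℝ < ⟪G.c i, w⟫_ℝ :=
        lt_of_le_of_ne (hl i w hi) fun h => hw ⟨i, hi, h.symm⟩
      refine ⟨(⟪G.c i, w⟫_ℝ - ⟪l, w⟫_ℝ) / 2, by linarith, ?_⟩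
      have hc : Continuous fun p : ℝ × F =>
          ⟪G.c i, p.2⟫_ℝ + 1 / 2 * p.1 * ⟪G.A i p.2, p.2⟫_ℝ - ⟪l, p.2⟫_ℝ := by fun_prop
      have h1 : Tendsto (fun p : ℝ × F => p) (𝓝[>] (0 : ℝ) ×ˢ 𝓝 w) (𝓝 (0, w)) := by
        rw [nhds_prod_eq]
        exact prod_mono_left _ nhdsWithin_le_nhds
      have h2 := ((hc.tendsto (0, w)).comp h1).eventually
        (lt_mem_nhds (a := (⟪G.c i, w⟫_ℝ - ⟪l, w⟫_ℝ) / 2) (by simp; linarith))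
      filter_upwards [h2] with p hp _
      simp only [Function.comp_apply] at hp
      linarith
    · refine ⟨1, one_pos, ?_⟩
      filter_upwards [eventually_not_mem_polarCone hi] with p hp hp'
      exact absurd hp' hp
  choose ε hε hev using key
  obtain ⟨δ, hδ, hδε⟩ : ∃ δ : ℝ, 0 < δ ∧ ∀ i, δ ≤ ε i := by
    rcases isEmpty_or_nonempty G.ι with hemp | hne
    · exact ⟨1, one_pos, fun i => hemp.elim i⟩
    · obtain ⟨i, hi⟩ := Finite.exists_min ε
      exact ⟨ε i, hε i, hi⟩
  refine ⟨δ, hδ, ?_⟩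
  filter_upwards [eventually_all.mpr hev, G.eventually_exists_smul w, eventually_fst_pos w]
    with p h1 h2 ht hD
  obtain ⟨i, hi, hgi⟩ := h2 hD
  rw [hgi]
  nlinarith [mul_le_mul_of_nonneg_left (h1 i hi) ht.le, mul_le_mul_of_nonneg_left (hδε i) ht.le]

/-- Second-order growth. -/
theorem eventually_growth_of_lt {i : G.ι} (hl : ∀ y ∈ D, g y₀ + ⟪l, y - y₀⟫_ℝ ≤ g y)
    (hi : w ∈ polarCone (G.normals i)) {M : ℝ} (hM : M < ⟪G.A i w, w⟫_ℝ) :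
    ∀ᶠ p : ℝ × F in 𝓝[>] (0 : ℝ) ×ˢ 𝓝 w, y₀ + p.1 • p.2 ∈ D →
      g y₀ + p.1 * ⟪l, p.2⟫_ℝ + 1 / 2 * p.1 ^ 2 * M ≤ g (y₀ + p.1 • p.2) := by
  rw [G.forall_subgradient_iff] at hl
  have key : ∀ j, ∀ᶠ p : ℝ × F in 𝓝[>] (0 : ℝ) ×ˢ 𝓝 w,
      p.2 ∈ polarCone (G.normals j) → M ≤ ⟪G.A j p.2, p.2⟫_ℝ := by
    intro j
    by_cases hj : w ∈ polarCone (G.normals j)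
    -- Nearby directions may lie in other pieces through `w`, all of which share the curvature at
    -- `w`.
    · rw [G.inner_A_eq hi hj] at hM
      have hc : Continuous fun u : F => ⟪G.A j u, u⟫_ℝ := by fun_prop
      have := tendsto_snd (f := 𝓝[>] (0 : ℝ)).eventually
        ((hc.tendsto w).eventually (lt_mem_nhds hM))
      exact this.mono fun p hp _ => le_of_lt hp
    · filter_upwards [eventually_not_mem_polarCone hj] with p hp hp'
      exact absurd hp' hp
  filter_upwards [eventually_all.mpr key, G.eventually_exists_smul w, eventually_fst_pos w]
    with p h1 h2 ht hD
  obtain ⟨j, hj, hgj⟩ := h2 hD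
  rw [hgj]
  have h3 := mul_le_mul_of_nonneg_left (h1 j hj) (by positivity : 0 ≤ 1 / 2 * p.1 ^ 2)
  have h4 := mul_le_mul_of_nonneg_left (hl j p.2 hj) ht.le
  linarith

end PLQGerm

/-! ### Second-order Taylor expansion along converging directions -/

section Taylor

open Asymptotics

variable {E F : Type*} [NormedAddCommGroup E] [InnerProductSpace ℝ E]
  [NormedAddCommGroup F] [InnerProductSpace ℝ F] {f : E → F} {x : E}

/-- The second-order Taylor expansion with Peano remainder. -/
theorem TwiceDifferentiableAt.isLittleO (hf : TwiceDifferentiableAt f x) :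
    (fun h => f (x + h) - f x - fderiv ℝ f x h - (1 / 2 : ℝ) • secondDeriv f x h h)
      =o[𝓝 0] fun h => ‖h‖ ^ 2 := by
  obtain ⟨hd, h2⟩ := hf
  have hsymm : ∀ u w, fderiv ℝ (fderiv ℝ f) x u w = fderiv ℝ (fderiv ℝ f) x w u := fun u w =>
    second_derivative_symmetric_of_eventually_of_real
      (hd.mono fun y hy => hy.hasFDerivAt) h2.hasFDerivAt u w
  refine isLittleO_iff.mpr fun ε hε => ?_
  have hsmall := isLittleO_iff.mp (hasFDerivAt_iff_isLittleO_nhds_zero.mp h2.hasFDerivAt) hε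
  have hshift : Tendsto (fun h : E => x + h) (𝓝 0) (𝓝 x) := by
    have : Continuous fun h : E => x + h := by fun_prop
    simpa using this.tendsto 0
  obtain ⟨r, hr, hball⟩ := Metric.eventually_nhds_iff_ball.mp (hsmall.and (hshift.eventually hd))
  filter_upwards [Metric.ball_mem_nhds (0 : E) hr] with h hh
  -- By symmetry of the second derivative, `R` has derivative `∇f(x + k) - ∇f(x) - B k`, bounded by
  -- `ε * ‖h‖` on the ball of radius `‖h‖`; the mean value inequality gives `ε * ‖h‖ ^ 2`.
  let R : E → F := fun h =>
    f (x + h) - f x - fderiv ℝ f x h - (1 / 2 : ℝ) • secondDeriv f x h h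
  let B := fderiv ℝ (fderiv ℝ f) x
  have hder : ∀ k ∈ Metric.closedBall (0 : E) ‖h‖, HasFDerivWithinAt R
      (fderiv ℝ f (x + k) - fderiv ℝ f x - B k) (Metric.closedBall (0 : E) ‖h‖) k := by
    intro k hk
    have hkr : k ∈ Metric.ball (0 : E) r := by
      rw [Metric.mem_ball, dist_zero_right] at hh ⊢
      rw [Metric.mem_closedBall, dist_zero_right] at hk
      exact hk.trans_lt hh
    have h1 : HasFDerivAt (fun h => f (x + h)) (fderiv ℝ f (x + k)) k :=
      (hasFDerivAt_comp_add_left x).mpr (hball k hkr).2.hasFDerivAt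
    have h3 : HasFDerivAt (fun h => (1 / 2 : ℝ) • B h h) (B k) k := by
      have h4 := ((B.hasFDerivAt (x := k)).clm_apply (hasFDerivAt_id k)).const_smul (1 / 2 : ℝ)
      refine h4.congr_fderiv (ContinuousLinearMap.ext fun u => ?_)
      change (1 / 2 : ℝ) • (B k u + B u k) = B k u
      rw [show B u k = B k u from hsymm u k]
      module
    exact ((((h1.sub_const (f x)).sub (fderiv ℝ f x).hasFDerivAt)).sub h3).hasFDerivWithinAt
  have hbound : ∀ k ∈ Metric.closedBall (0 : E) ‖h‖,
      ‖fderiv ℝ f (x + k) - fderiv ℝ f x - B k‖ ≤ ε * ‖h‖ := by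
    intro k hk
    have hkr : k ∈ Metric.ball (0 : E) r := by
      rw [Metric.mem_ball, dist_zero_right] at hh ⊢
      rw [Metric.mem_closedBall, dist_zero_right] at hk
      exact hk.trans_lt hh
    refine (hball k hkr).1.trans (mul_le_mul_of_nonneg_left ?_ hε.le)
    simpa using hk
  have := (convex_closedBall (0 : E) ‖h‖).norm_image_sub_le_of_norm_hasFDerivWithin_le hder hbound
    (Metric.mem_closedBall_self (norm_nonneg h)) (by simp : h ∈ Metric.closedBall (0 : E) ‖h‖)
  have hR0 : R 0 = 0 := by simp [R, secondDeriv]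
  rw [hR0, sub_zero, sub_zero] at this
  rw [Real.norm_of_nonneg (by positivity), sq, ← mul_assoc]
  exact this

variable {α : Type*} {k : Filter α} {τ : α → ℝ} {u : α → E} {w : E}

/-- The linear term is taken at `u a` rather than `w`, so no rate of convergence of `u` is needed.
-/
theorem TwiceDifferentiableAt.tendsto_secondOrder (hf : TwiceDifferentiableAt f x)
    (hτ : Tendsto τ k (𝓝[>] 0)) (hu : Tendsto u k (𝓝 w)) :
    Tendsto (fun a => (1 / 2 * τ a ^ 2)⁻¹ • (f (x + τ a • u a) - f x - τ a • fderiv ℝ f x (u a))) k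
      (𝓝 (secondDeriv f x w w)) := by
  have hτ0 : Tendsto τ k (𝓝 0) := hτ.mono_right nhdsWithin_le_nhds
  have hτpos : ∀ᶠ a in k, 0 < τ a := hτ.eventually self_mem_nhdsWithin
  have h1 : Tendsto (fun a => τ a • u a) k (𝓝 0) := by simpa using hτ0.smul hu
  have h2 := hf.isLittleO.comp_tendsto h1
  have h3 : (fun a => ‖τ a • u a‖ ^ 2) =O[k] fun a => 1 / 2 * τ a ^ 2 := by
    have hb : (fun a => ‖u a‖ ^ 2) =O[k] fun _ => (1 : ℝ) := (hu.norm.pow 2).isBigO_one ℝ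
    have : (fun a => τ a ^ 2 * ‖u a‖ ^ 2) =O[k] fun a => 1 / 2 * τ a ^ 2 * 1 := by
      refine IsBigO.mul ?_ hb
      exact IsBigO.of_bound 2 (Eventually.of_forall fun a => by
        rw [norm_mul]; norm_num; linarith)
    refine (this.congr_left fun a => ?_).congr_right fun a => mul_one _
    rw [norm_smul, mul_pow, Real.norm_eq_abs, sq_abs]
  have h4 := (h2.trans_isBigO h3).tendsto_inv_smul_nhds_zero
  have hc : Continuous fun u : E => secondDeriv f x u u := by
    unfold secondDeriv
    fun_prop
  have h5 := h4.add ((hc.tendsto w).comp hu)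
  rw [zero_add] at h5
  refine h5.congr' ?_
  filter_upwards [hτpos] with a ha
  have hne : (1 / 2 * τ a ^ 2) ≠ 0 := by positivity
  have hB : secondDeriv f x (τ a • u a) (τ a • u a) = τ a ^ 2 • secondDeriv f x (u a) (u a) := by
    simp [secondDeriv, smul_smul, sq]
  simp only [Function.comp_apply, hB, map_smul]
  rw [smul_sub _ _ ((1 / 2 : ℝ) • _), smul_smul (1 / 2 : ℝ), smul_smul, inv_mul_cancel₀ hne,
    one_smul, sub_add_cancel]

theorem TwiceDifferentiableAt.tendsto_firstOrder (hf : TwiceDifferentiableAt f x)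
    (hτ : Tendsto τ k (𝓝[>] 0)) (hu : Tendsto u k (𝓝 w)) :
    Tendsto (fun a => (τ a)⁻¹ • (f (x + τ a • u a) - f x)) k (𝓝 (fderiv ℝ f x w)) := by
  have hτ0 : Tendsto τ k (𝓝 0) := hτ.mono_right nhdsWithin_le_nhds
  have h1 := (hτ0.div_const 2).smul (hf.tendsto_secondOrder hτ hu)
  have h2 := (((fderiv ℝ f x).continuous.tendsto w).comp hu).add h1
  rw [zero_div, zero_smul, add_zero] at h2
  refine h2.congr' ?_
  filter_upwards [hτ.eventually self_mem_nhdsWithin] with a ha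
  have ha : 0 < τ a := ha
  have h3 : τ a / 2 * (1 / 2 * τ a ^ 2)⁻¹ = (τ a)⁻¹ := by field_simp
  simp only [Function.comp_apply]
  rw [smul_smul, h3, smul_sub, smul_smul, inv_mul_cancel₀ ha.ne', one_smul, add_sub_cancel]

/-- Scaled directions are mapped to scaled directions. -/
theorem TwiceDifferentiableAt.tendsto_directions (hf : TwiceDifferentiableAt f x) (w : E) :
    Tendsto (fun p : ℝ × E => (p.1, p.1⁻¹ • (f (x + p.1 • p.2) - f x)))
      (𝓝[>] (0 : ℝ) ×ˢ 𝓝 w) (𝓝[>] (0 : ℝ) ×ˢ 𝓝 (fderiv ℝ f x w)) :=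
  tendsto_fst.prodMk (hf.tendsto_firstOrder tendsto_fst tendsto_snd)

end Taylor

/-! ### Lower estimate in the chain rule -/

section LowerBound

variable {E F : Type*} [NormedAddCommGroup E] [InnerProductSpace ℝ E]
  [NormedAddCommGroup F] [InnerProductSpace ℝ F] {φ : E → EReal} {f : E → F} {θ : F → EReal}
  {x v w : E} {l : F}

theorem add_smul_inv_smul_sub {t : ℝ} (ht : 0 < t) (y z : F) : y + t • t⁻¹ • (z - y) = z := by
  rw [smul_smul, mul_inv_cancel₀ ht.ne', one_smul, add_sub_cancel]

/-- The lower estimate in the chain rule for second subderivatives. -/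
theorem coe_add_inner_le_secondSubderivative (hcomp : ∀ᶠ y in 𝓝 x, φ y = θ (f y))
    (hf : TwiceDifferentiableAt f x) (hbot : ∀ y, θ y ≠ ⊥) (hx : f x ∈ dom θ)
    (hl : ∀ u, ⟪v, u⟫_ℝ = ⟪l, fderiv ℝ f x u⟫_ℝ) {M : ℝ}
    (hM : (M : EReal) < secondSubderivative θ (f x) l (fderiv ℝ f x w)) :
    ((M + ⟪l, secondDeriv f x w w⟫_ℝ : ℝ) : EReal) ≤ secondSubderivative φ x v w := by
  have hfx : θ (f x) = ((θ (f x)).toReal : EReal) := (coe_toReal_of_mem_dom hbot hx).symm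
  have hφx : φ x = ((θ (f x)).toReal : EReal) := hcomp.self_of_nhds.trans hfx
  -- The quotient of `φ` at `(t, u)` equals that of `θ` at `(t, t⁻¹ • (f (x + t • u) - f x))` plus
  -- the pairing of `l` with the Taylor quotient, because `⟪v, u⟫ = ⟪l, L u⟫`.
  have h1 := (hf.tendsto_directions w).eventually (eventually_lt_of_lt_liminf hM)
  have h2 : Tendsto (fun p : ℝ × E => ⟪l, (1 / 2 * p.1 ^ 2)⁻¹ •
      (f (x + p.1 • p.2) - f x - p.1 • fderiv ℝ f x p.2)⟫_ℝ) (𝓝[>] (0 : ℝ) ×ˢ 𝓝 w)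
      (𝓝 ⟪l, secondDeriv f x w w⟫_ℝ) :=
    tendsto_const_nhds.inner (hf.tendsto_secondOrder tendsto_fst tendsto_snd)
  refine EReal.ge_of_forall_gt_iff_ge.mp fun z hz => ?_
  rw [EReal.coe_lt_coe_iff] at hz
  apply le_secondSubderivative
  filter_upwards [h1, h2.eventually (lt_mem_nhds (a := z - M) (by linarith)),
    eventually_fst_pos w, (tendsto_add_smul x w).eventually hcomp] with p hp hq ht hφ
  by_cases hD : f (x + p.1 • p.2) ∈ dom θ
  · have hb := coe_toReal_of_mem_dom hbot hD
    rw [secondQuotient_of_eq_coe hφx (hφ.trans hb.symm), EReal.coe_le_coe_iff]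
    rw [secondQuotient_of_eq_coe hfx (by rw [add_smul_inv_smul_sub ht]; exact hb.symm),
      EReal.coe_lt_coe_iff, lt_div_iff₀ (by positivity), inner_smul_right,
      mul_inv_cancel_left₀ ht.ne'] at hp
    rw [inner_smul_right, lt_inv_mul_iff₀ (by positivity), inner_sub_right, inner_smul_right,
      ← hl] at hq
    rw [le_div_iff₀ (by positivity)]
    linarith
  · have htop : φ (x + p.1 • p.2) = ⊤ := by
      rw [hφ]
      exact not_lt_top_iff.mp hD
    rw [secondQuotient_of_eq_top ht hφx htop]
    exact le_top

end LowerBound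

/-! ### Second subderivatives of germs and critical directions -/

section Germ

variable {F : Type*} [NormedAddCommGroup F] [InnerProductSpace ℝ F] {θ : F → EReal} {y₀ l w : F}

/-- The second subderivative of a convex piecewise linear-quadratic function in a critical
direction. -/
theorem PLQGerm.secondSubderivative_eq (G : PLQGerm (dom θ) (fun y => (θ y).toReal) y₀)
    (hbot : ∀ y, θ y ≠ ⊥)
    (hl : ∀ y ∈ dom θ, (θ y₀).toReal + ⟪l, y - y₀⟫_ℝ ≤ (θ y).toReal) {i : G.ι}
    (hi : w ∈ polarCone (G.normals i)) (hc : ⟪G.c i, w⟫_ℝ = ⟪l, w⟫_ℝ) :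
    secondSubderivative θ y₀ l w = (⟪G.A i w, w⟫_ℝ : ℝ) := by
  have h0 : θ y₀ = ((θ y₀).toReal : EReal) := (coe_toReal_of_mem_dom hbot G.mem).symm
  refine le_antisymm ?_ ?_
  · refine secondSubderivative_le_of_tendsto (γ := fun _ => w) (B := fun _ => ⟪G.A i w, w⟫_ℝ)
      tendsto_const_nhds tendsto_const_nhds ?_
    filter_upwards [G.eventually_mem i w hi, self_mem_nhdsWithin] with t ht ht0
    have ht0 : 0 < t := ht0
    rw [secondQuotient_of_eq_coe h0 (coe_toReal_of_mem_dom hbot ht.1).symm, EReal.coe_le_coe_iff,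
      div_le_iff₀ (by positivity), ht.2, hc]
    linarith
  · refine EReal.ge_of_forall_gt_iff_ge.mp fun z hz => ?_
    rw [EReal.coe_lt_coe_iff] at hz
    apply le_secondSubderivative
    filter_upwards [G.eventually_growth_of_lt hl hi hz, eventually_fst_pos w] with p hp ht
    by_cases hD : y₀ + p.1 • p.2 ∈ dom θ
    · rw [secondQuotient_of_eq_coe h0 (coe_toReal_of_mem_dom hbot hD).symm, EReal.coe_le_coe_iff,
        le_div_iff₀ (by positivity)]
      linarith [hp hD]
    · rw [secondQuotient_of_eq_top ht h0 (not_lt_top_iff.mp hD)]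
      exact le_top

/-- The second subderivative is infinite in noncritical directions. -/
theorem PLQGerm.secondSubderivative_eq_top (G : PLQGerm (dom θ) (fun y => (θ y).toReal) y₀)
    (hbot : ∀ y, θ y ≠ ⊥)
    (hl : ∀ y ∈ dom θ, (θ y₀).toReal + ⟪l, y - y₀⟫_ℝ ≤ (θ y).toReal)
    (hw : ¬ G.IsCritical l w) : secondSubderivative θ y₀ l w = ⊤ := by
  have h0 : θ y₀ = ((θ y₀).toReal : EReal) := (coe_toReal_of_mem_dom hbot G.mem).symm
  obtain ⟨ε, hε, hev⟩ := G.exists_growth_of_not_isCritical hl hw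
  refine top_le_iff.mp (EReal.ge_of_forall_gt_iff_ge.mp fun z _ => ?_)
  apply le_secondSubderivative
  have hsmall : ∀ᶠ p : ℝ × F in 𝓝[>] (0 : ℝ) ×ˢ 𝓝 w, 1 / 2 * p.1 * z < ε := by
    have : Tendsto (fun p : ℝ × F => 1 / 2 * p.1 * z) (𝓝[>] (0 : ℝ) ×ˢ 𝓝 w) (𝓝 0) := by
      have h := ((tendsto_fst_zero w).const_mul (1 / 2)).mul_const z
      rwa [mul_zero, zero_mul] at h
    exact this.eventually_lt_const hε
  filter_upwards [hev, eventually_fst_pos w, hsmall] with p hp ht hz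
  by_cases hD : y₀ + p.1 • p.2 ∈ dom θ
  · rw [secondQuotient_of_eq_coe h0 (coe_toReal_of_mem_dom hbot hD).symm, EReal.coe_le_coe_iff,
      le_div_iff₀ (by positivity)]
    nlinarith [hp hD]
  · rw [secondQuotient_of_eq_top ht h0 (not_lt_top_iff.mp hD)]
    exact le_top

variable {E : Type*} [NormedAddCommGroup E] [InnerProductSpace ℝ E] {φ : E → EReal} {f : E → F}
  {x v z : E}

/-- Critical directions of a composition are mapped to critical directions. -/
theorem PLQGerm.isCritical_of_mem_criticalCone
    (G : PLQGerm (dom θ) (fun y => (θ y).toReal) (f x)) (hbot : ∀ y, θ y ≠ ⊥)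
    (hcomp : ∀ᶠ y in 𝓝 x, φ y = θ (f y)) (hf : TwiceDifferentiableAt f x)
    (hl : ∀ y ∈ dom θ, (θ (f x)).toReal + ⟪l, y - f x⟫_ℝ ≤ (θ y).toReal)
    (hv : ∀ u, ⟪v, u⟫_ℝ = ⟪l, fderiv ℝ f x u⟫_ℝ) (hz : z ∈ criticalCone φ x v) :
    G.IsCritical l (fderiv ℝ f x z) := by
  by_contra hw
  have hφx : φ x = ((θ (f x)).toReal : EReal) :=
    hcomp.self_of_nhds.trans (coe_toReal_of_mem_dom hbot G.mem).symm
  obtain ⟨ε, hε, hev⟩ := G.exists_growth_of_not_isCritical hl hw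
  have h1 : Tendsto (fun p : ℝ × E => ⟪l, p.1⁻¹ • (f (x + p.1 • p.2) - f x)⟫_ℝ)
      (𝓝[>] (0 : ℝ) ×ˢ 𝓝 z) (𝓝 ⟪l, fderiv ℝ f x z⟫_ℝ) :=
    tendsto_const_nhds.inner (hf.tendsto_firstOrder tendsto_fst tendsto_snd)
  -- Half of the growth `ε` absorbs the first-order error of `f`; the rest makes the subderivative
  -- exceed `⟪v, z⟫`.
  have h2 : ((⟪v, z⟫_ℝ + ε / 2 : ℝ) : EReal) ≤ subderivative φ x z := by
    refine le_liminf_of_le (by isBoundedDefault) ?_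
    filter_upwards [(hf.tendsto_directions z).eventually hev, eventually_fst_pos z,
      h1.eventually (lt_mem_nhds (a := ⟪l, fderiv ℝ f x z⟫_ℝ - ε / 2) (by linarith)),
      (tendsto_add_smul x z).eventually hcomp] with p hp ht hq hφ
    rw [add_smul_inv_smul_sub ht] at hp
    by_cases hD : f (x + p.1 • p.2) ∈ dom θ
    · rw [hφ, hφx, ← coe_toReal_of_mem_dom hbot hD, ← EReal.coe_sub, ← EReal.coe_div,
        EReal.coe_le_coe_iff, le_div_iff₀ ht, hv]
      have := hp hD
      nlinarith
    · rw [hφ, hφx, show θ (f (x + p.1 • p.2)) = ⊤ from not_lt_top_iff.mp hD, EReal.top_sub_coe,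
        EReal.top_div_of_pos_ne_top (by exact_mod_cast ht) (EReal.coe_ne_top _)]
      exact le_top
  rw [show subderivative φ x z = _ from hz, EReal.coe_le_coe_iff] at h2
  linarith

end Germ

/-! ### Upper estimate along parabolic arcs -/

section UpperBound

/-- Points moved by the qualification condition into the domain of the composition. -/
theorem exists_mem_preimage_dom {E F : Type*} [NormedAddCommGroup E] [NormedAddCommGroup F]
    {f : E → F} {θ : F → EReal} {x : E} {κ : ℝ} (hκ : 0 ≤ κ) {ξ : ℝ → E} {y : ℝ → F} (hx : f x ∈ dom θ)
    (hms : ∀ᶠ y in 𝓝 x, Metric.infDist y {z | f z ∈ dom θ} ≤ κ * Metric.infDist (f y) (dom θ))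
    (hξ : Tendsto ξ (𝓝[>] 0) (𝓝 x)) (hy : ∀ᶠ t in 𝓝[>] (0 : ℝ), y t ∈ dom θ) :
    ∃ η : ℝ → E, ∀ᶠ t in 𝓝[>] (0 : ℝ), f (η t) ∈ dom θ ∧
      ‖η t - ξ t‖ ≤ κ * ‖f (ξ t) - y t‖ + t ^ 3 := by
  have h : ∀ t, ∃ η, (0 < t ∧ y t ∈ dom θ ∧ Metric.infDist (ξ t) {z | f z ∈ dom θ} ≤
      κ * Metric.infDist (f (ξ t)) (dom θ)) → f η ∈ dom θ ∧
      ‖η - ξ t‖ ≤ κ * ‖f (ξ t) - y t‖ + t ^ 3 := by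
    intro t
    by_cases hc : 0 < t ∧ y t ∈ dom θ ∧ Metric.infDist (ξ t) {z | f z ∈ dom θ} ≤
      κ * Metric.infDist (f (ξ t)) (dom θ)
    · obtain ⟨ht, hyt, hle⟩ := hc
      -- The distance need not be attained; the slack `t ^ 3` is negligible against `t ^ 2`.
      have h1 : Metric.infDist (ξ t) {z | f z ∈ dom θ} < κ * ‖f (ξ t) - y t‖ + t ^ 3 := by
        have h2 := mul_le_mul_of_nonneg_left (Metric.infDist_le_dist_of_mem (x := f (ξ t)) hyt) hκ
        rw [dist_eq_norm] at h2
        have : 0 < t ^ 3 := by positivity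
        linarith
      obtain ⟨η, hη, hlt⟩ := (Metric.infDist_lt_iff ⟨x, hx⟩).mp h1
      rw [dist_eq_norm, norm_sub_rev] at hlt
      exact ⟨η, fun _ => ⟨hη, hlt.le⟩⟩
    · exact ⟨x, fun h => absurd h hc⟩
  choose η hη using h
  refine ⟨η, ?_⟩
  filter_upwards [self_mem_nhdsWithin, hy, hξ.eventually hms] with t h1 h2 h3
  exact hη t ⟨h1, h2, h3⟩

variable {E F : Type*} [NormedAddCommGroup E] [InnerProductSpace ℝ E]
  [NormedAddCommGroup F] [InnerProductSpace ℝ F] {φ : E → EReal} {f : E → F} {θ : F → EReal}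
  {x : E}

/-- The upper estimate of the second subderivative of a composition along a parabolic arc. -/
theorem exists_secondSubderivative_le (G : PLQGerm (dom θ) (fun y => (θ y).toReal) (f x))
    (hbot : ∀ y, θ y ≠ ⊥) (hcomp : ∀ᶠ y in 𝓝 x, φ y = θ (f y))
    (hf : TwiceDifferentiableAt f x) (hms : MSQC f θ x) (v w : E) :
    ∃ C : ℝ, ∀ (z : E) (P : F) (B : ℝ → ℝ) (b : ℝ), Tendsto B (𝓝[>] 0) (𝓝 b) →
      (∀ᶠ t in 𝓝[>] (0 : ℝ),
        f x + t • fderiv ℝ f x w + (1 / 2 * t ^ 2) • P ∈ dom θ ∧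
        (θ (f x + t • fderiv ℝ f x w + (1 / 2 * t ^ 2) • P)).toReal ≤
          (θ (f x)).toReal + t * ⟪v, w⟫_ℝ + 1 / 2 * t ^ 2 * B t) →
      secondSubderivative φ x v w ≤
        ((b - ⟪v, z⟫_ℝ + C * ‖secondDeriv f x w w + fderiv ℝ f x z - P‖ : ℝ) : EReal) := by
  obtain ⟨κ, hκ, hms⟩ := hms
  obtain ⟨ℓ, hℓ, hlip⟩ := G.lipschitz
  set L := fderiv ℝ f x with hL
  -- The point of the arc in `E` is moved into the domain by `1/2 * t ^ 2 • ρ t`, where `ρ` is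
  -- asymptotically at most `κ` times the mismatch. This costs `‖v‖ * κ` in the linear term and,
  -- through the Lipschitz constant, `ℓ * (1 + ‖L‖ * κ)` in the value of `θ`.
  refine ⟨‖v‖ * κ + ℓ * (1 + ‖L‖ * κ), fun z P B b hB hy => ?_⟩
  set q := secondDeriv f x w w with hq
  have hid : Tendsto (fun t : ℝ => t) (𝓝[>] 0) (𝓝[>] 0) := tendsto_id
  have hid0 : Tendsto (fun t : ℝ => t) (𝓝[>] 0) (𝓝 0) := nhdsWithin_le_nhds
  have hpos : ∀ᶠ t in 𝓝[>] (0 : ℝ), 0 < t := self_mem_nhdsWithin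
  let u : ℝ → E := fun t => w + (t / 2) • z
  let y : ℝ → F := fun t => f x + t • L w + (1 / 2 * t ^ 2) • P
  let e : ℝ → F := fun t => (1 / 2 * t ^ 2)⁻¹ • (f (x + t • u t) - y t)
  have hu : Tendsto u (𝓝[>] 0) (𝓝 w) := by
    have : Continuous u := by fun_prop
    simpa [u] using (this.tendsto 0).mono_left nhdsWithin_le_nhds
  have hξ : Tendsto (fun t => x + t • u t) (𝓝[>] 0) (𝓝 x) := by
    simpa using tendsto_const_nhds.add (hid0.smul hu)
  have he : Tendsto e (𝓝[>] 0) (𝓝 (q + L z - P)) := by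
    have h1 := ((hf.tendsto_secondOrder hid hu).add_const (L z)).sub_const P
    refine h1.congr' ?_
    filter_upwards [hpos] with t ht
    have hne : 1 / 2 * t ^ 2 ≠ 0 := by positivity
    have h2 : f (x + t • u t) - y t = (f (x + t • u t) - f x - t • L (u t)) +
        (1 / 2 * t ^ 2) • (L z - P) := by
      simp only [u, y, map_add, map_smul]
      module
    change _ = (1 / 2 * t ^ 2)⁻¹ • (f (x + t • u t) - y t)
    rw [h2, smul_add (1 / 2 * t ^ 2)⁻¹, smul_smul (1 / 2 * t ^ 2)⁻¹, inv_mul_cancel₀ hne, one_smul,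
      add_sub_assoc]
  obtain ⟨η, hη⟩ := exists_mem_preimage_dom hκ G.mem hms hξ (hy.mono fun t h => h.1)
  let ρ : ℝ → E := fun t => (1 / 2 * t ^ 2)⁻¹ • (η t - (x + t • u t))
  have hρ : ∀ᶠ t in 𝓝[>] (0 : ℝ), ‖ρ t‖ ≤ κ * ‖e t‖ + 2 * t := by
    filter_upwards [hη, hpos] with t h1 ht
    have hp : 0 < 1 / 2 * t ^ 2 := by positivity
    simp only [ρ, e, norm_smul, norm_inv, Real.norm_of_nonneg hp.le]
    rw [inv_mul_le_iff₀ hp]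
    refine h1.2.trans (le_of_eq ?_)
    change κ * ‖f (x + t • u t) - y t‖ + t ^ 3 = _
    field_simp
  have hbound : Tendsto (fun t => κ * ‖e t‖ + 2 * t) (𝓝[>] 0) (𝓝 (κ * ‖q + L z - P‖)) := by
    simpa using (he.norm.const_mul κ).add (hid0.const_mul 2)
  -- The correction is of order `t ^ 2`, so it only perturbs the direction by a vanishing amount.
  let γ : ℝ → E := fun t => u t + (t / 2) • ρ t
  have hηγ : ∀ t, 0 < t → x + t • γ t = η t := by
    intro t ht
    have hp : (1 / 2 * t ^ 2) ≠ 0 := by positivity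
    have : t • (t / 2) • ρ t = η t - (x + t • u t) := by
      simp only [ρ]
      rw [smul_smul, smul_smul, show t * (t / 2) * (1 / 2 * t ^ 2)⁻¹ = 1 by field_simp, one_smul]
    simp only [γ]
    rw [smul_add, this]
    abel
  have hγ : Tendsto γ (𝓝[>] 0) (𝓝 w) := by
    have h1 : Tendsto (fun t => (t / 2) • ρ t) (𝓝[>] 0) (𝓝 0) := by
      rw [tendsto_zero_iff_norm_tendsto_zero]
      have h2 : Tendsto (fun t => t / 2 * (κ * ‖e t‖ + 2 * t)) (𝓝[>] 0) (𝓝 0) := by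
        simpa using (hid0.div_const 2).mul hbound
      refine squeeze_zero' (Eventually.of_forall fun t => norm_nonneg _) ?_ h2
      filter_upwards [hρ, hpos] with t h3 ht
      rw [norm_smul, Real.norm_of_nonneg (by positivity)]
      exact mul_le_mul_of_nonneg_left h3 (by positivity)
    simpa using hu.add h1
  let s : ℝ → F := fun t => (1 / 2 * t ^ 2)⁻¹ • (f (x + t • γ t) - f x - t • L (γ t))
  have hs : Tendsto s (𝓝[>] 0) (𝓝 q) := hf.tendsto_secondOrder hid hγ
  have hfη : ∀ᶠ t in 𝓝[>] (0 : ℝ), f (η t) ∈ Metric.ball (f x) 1 := by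
    have h1 : Tendsto (fun t => x + t • γ t) (𝓝[>] 0) (𝓝 x) := by
      simpa using tendsto_const_nhds.add (hid0.smul hγ)
    have h2 := (hf.1.self_of_nhds.continuousAt.tendsto.comp h1).eventually
      (Metric.ball_mem_nhds (f x) one_pos)
    filter_upwards [h2, hpos] with t h3 ht
    rwa [Function.comp_apply, hηγ t ht] at h3
  have hyball : ∀ᶠ t in 𝓝[>] (0 : ℝ), y t ∈ Metric.ball (f x) 1 := by
    have hc : Continuous y := by fun_prop
    have : Tendsto y (𝓝[>] 0) (𝓝 (f x)) := by
      simpa [y] using (hc.tendsto 0).mono_left nhdsWithin_le_nhds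
    exact this.eventually (Metric.ball_mem_nhds (f x) one_pos)
  let B' : ℝ → ℝ := fun t => B t - ⟪v, z⟫_ℝ + ‖v‖ * (κ * ‖e t‖ + 2 * t) +
    ℓ * (‖s t + L z - P‖ + ‖L‖ * (κ * ‖e t‖ + 2 * t))
  have hB' : Tendsto B' (𝓝[>] 0) (𝓝 (b - ⟪v, z⟫_ℝ +
      (‖v‖ * κ + ℓ * (1 + ‖L‖ * κ)) * ‖q + L z - P‖)) := by
    have h1 := ((hB.sub_const ⟪v, z⟫_ℝ).add (hbound.const_mul ‖v‖)).add
      (((((hs.add_const (L z)).sub_const P).norm).add (hbound.const_mul ‖L‖)).const_mul ℓ)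
    convert h1 using 2
    ring
  refine secondSubderivative_le_of_tendsto hγ hB' ?_
  have h0 : φ x = ((θ (f x)).toReal : EReal) :=
    hcomp.self_of_nhds.trans (coe_toReal_of_mem_dom hbot G.mem).symm
  have hγx : Tendsto (fun t => x + t • γ t) (𝓝[>] 0) (𝓝 x) := by
    simpa using tendsto_const_nhds.add (hid0.smul hγ)
  filter_upwards [hpos, hη, hρ, hfη, hyball, hy, hγx.eventually hcomp]
    with t ht h1 h2 h3 h4 h5 h6
  have hp : 0 < 1 / 2 * t ^ 2 := by positivity
  have hφη : φ (x + t • γ t) = ((θ (f (η t))).toReal : EReal) := by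
    rw [h6, hηγ t ht]
    exact (coe_toReal_of_mem_dom hbot h1.1).symm
  rw [secondQuotient_of_eq_coe h0 hφη, EReal.coe_le_coe_iff, div_le_iff₀ hp]
  have hg : (θ (f (η t))).toReal ≤ (θ (y t)).toReal + ℓ * ‖f (η t) - y t‖ :=
    hlip _ ⟨h5.1, h4⟩ _ ⟨h1.1, h3⟩
  have hdiff : f (η t) - y t = (1 / 2 * t ^ 2) • (s t + L z - P + L (ρ t)) := by
    have h7 : (1 / 2 * t ^ 2) • s t = f (η t) - f x - t • L (γ t) := by
      simp only [s]
      rw [smul_smul, mul_inv_cancel₀ hp.ne', one_smul, hηγ t ht]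
    rw [smul_add, smul_sub, smul_add, h7]
    simp only [γ, u, y, map_add, map_smul]
    module
  have hnorm : ‖f (η t) - y t‖ ≤
      1 / 2 * t ^ 2 * (‖s t + L z - P‖ + ‖L‖ * (κ * ‖e t‖ + 2 * t)) := by
    rw [hdiff, norm_smul, Real.norm_of_nonneg hp.le]
    refine mul_le_mul_of_nonneg_left ((norm_add_le _ _).trans ?_) hp.le
    gcongr
    exact (L.le_opNorm _).trans (mul_le_mul_of_nonneg_left h2 (norm_nonneg _))
  have hinner : -⟪v, ρ t⟫_ℝ ≤ ‖v‖ * (κ * ‖e t‖ + 2 * t) := by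
    rw [← inner_neg_right]
    refine (real_inner_le_norm _ _).trans ?_
    rw [norm_neg]
    exact mul_le_mul_of_nonneg_left h2 (norm_nonneg _)
  have hγv : t * ⟪v, γ t⟫_ℝ =
      t * ⟪v, w⟫_ℝ + 1 / 2 * t ^ 2 * ⟪v, z⟫_ℝ + 1 / 2 * t ^ 2 * ⟪v, ρ t⟫_ℝ := by
    simp only [γ, u, inner_add_right, inner_smul_right]
    ring
  have h8 := h5.2
  have h9 := mul_le_mul_of_nonneg_left hnorm hℓ
  have h10 := mul_le_mul_of_nonneg_left hinner hp.le
  change (θ (y t)).toReal ≤ _ at h8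
  rw [hγv]
  simp only [B']
  linarith

end UpperBound

/-! ### Recoverable directions -/

section Recovery

variable {E F : Type*} [NormedAddCommGroup E] [InnerProductSpace ℝ E]
  [NormedAddCommGroup F] [InnerProductSpace ℝ F]

theorem tendsto_const_mul_nhdsGT_zero {c : ℝ} (hc : 0 < c) :
    Tendsto (fun t : ℝ => c * t) (𝓝[>] 0) (𝓝[>] 0) := by
  refine tendsto_nhdsWithin_iff.mpr ⟨?_, ?_⟩
  · have : Continuous fun t : ℝ => c * t := by fun_prop
    simpa using (this.tendsto 0).mono_left nhdsWithin_le_nhds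
  · filter_upwards [self_mem_nhdsWithin] with t ht
    exact mul_pos hc ht

/-- A pair `(p, s)` is recoverable if, up to a shift `L z`, the directional derivative of `g` at
`y₀` in direction `p` is at most `s` with a quadratic error. -/
def IsRecoverable (D : Set F) (g : F → ℝ) (y₀ : F) (L : E →L[ℝ] F) (v : E) (p : F) (s : ℝ) :
    Prop :=
  ∃ (z : E) (C : ℝ), ∀ᶠ t in 𝓝[>] (0 : ℝ), y₀ + t • (p + L z) ∈ D ∧
    g (y₀ + t • (p + L z)) ≤ g y₀ + t * (s + ⟪v, z⟫_ℝ) + C * t ^ 2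

variable {D : Set F} {g : F → ℝ} {y₀ : F} {L : E →L[ℝ] F} {v : E}

theorem IsRecoverable.zero (h0 : y₀ ∈ D) : IsRecoverable D g y₀ L v 0 0 :=
  ⟨0, 0, Eventually.of_forall fun t => by simpa using h0⟩

theorem IsRecoverable.smul (h0 : y₀ ∈ D) {p : F} {s c : ℝ} (hc : 0 ≤ c)
    (h : IsRecoverable D g y₀ L v p s) : IsRecoverable D g y₀ L v (c • p) (c * s) := by
  rcases hc.eq_or_lt with rfl | hc
  · simpa using IsRecoverable.zero h0
  · obtain ⟨z, C, h⟩ := h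
    refine ⟨c • z, C * c ^ 2, ?_⟩
    filter_upwards [(tendsto_const_mul_nhdsGT_zero hc).eventually h] with t ht
    have h1 : (c * t) • (p + L z) = t • (c • p + L (c • z)) := by
      rw [map_smul]
      module
    rw [h1] at ht
    refine ⟨ht.1, ht.2.trans (le_of_eq ?_)⟩
    rw [inner_smul_right]
    ring

/-- The midpoint of the two curves at parameter `2 * t` has the summed direction, and convexity
bounds its value. -/
theorem IsRecoverable.add (hg : ConvexOn ℝ D g) {p p' : F} {s s' : ℝ}
    (h : IsRecoverable D g y₀ L v p s) (h' : IsRecoverable D g y₀ L v p' s') :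
    IsRecoverable D g y₀ L v (p + p') (s + s') := by
  obtain ⟨z, C, h⟩ := h
  obtain ⟨z', C', h'⟩ := h'
  refine ⟨z + z', 2 * C + 2 * C', ?_⟩
  filter_upwards [(tendsto_const_mul_nhdsGT_zero two_pos).eventually (h.and h')] with t ht
  have h1 : y₀ + t • (p + p' + L (z + z')) =
      (1 / 2 : ℝ) • (y₀ + (2 * t) • (p + L z)) + (1 / 2 : ℝ) • (y₀ + (2 * t) • (p' + L z')) := by
    rw [map_add]
    module
  rw [h1]
  refine ⟨hg.1 ht.1.1 ht.2.1 (by norm_num) (by norm_num) (by norm_num), ?_⟩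
  have h2 := hg.2 ht.1.1 ht.2.1 (show (0 : ℝ) ≤ 1 / 2 by norm_num)
    (show (0 : ℝ) ≤ 1 / 2 by norm_num) (by norm_num)
  simp only [smul_eq_mul] at h2
  have h3 := ht.1.2
  have h4 := ht.2.2
  rw [inner_add_right]
  linarith

theorem IsRecoverable.sum {ι : Type*} (hg : ConvexOn ℝ D g) (h0 : y₀ ∈ D) (S : Finset ι)
    {p : ι → F} {σ c : ι → ℝ} (hc : ∀ k, 0 ≤ c k) (h : ∀ k, IsRecoverable D g y₀ L v (p k) (σ k)) :
    IsRecoverable D g y₀ L v (∑ k ∈ S, c k • p k) (∑ k ∈ S, c k * σ k) := by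
  classical
  induction S using Finset.induction_on with
  | empty => simpa using IsRecoverable.zero h0
  | insert k S hk ih =>
    rw [Finset.sum_insert hk, Finset.sum_insert hk]
    exact ((h k).smul h0 (hc k)).add hg ih

theorem PLQGerm.isRecoverable (G : PLQGerm D g y₀) {i : G.ι} {w : F}
    (hw : w ∈ polarCone (G.normals i)) : IsRecoverable D g y₀ L v w ⟪G.c i, w⟫_ℝ := by
  refine ⟨0, 1 / 2 * ⟪G.A i w, w⟫_ℝ, ?_⟩
  filter_upwards [G.eventually_mem i w hw] with t ht
  rw [map_zero, add_zero, inner_zero_right, add_zero]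
  exact ⟨ht.1, by rw [ht.2]; linarith⟩

/-- The shift by `-z` cancels `L z` and leaves a constant curve; the shift in `IsRecoverable` makes
room for directions in the range of `L`. -/
theorem isRecoverable_map (h0 : y₀ ∈ D) (z : E) : IsRecoverable D g y₀ L v (L z) ⟪v, z⟫_ℝ :=
  ⟨-z, 0, Eventually.of_forall fun t => by simpa using h0⟩

/-- The value of a convex function along a parabolic arc whose first-order part lies in a piece
and whose second-order part is recoverable. -/
theorem PLQGerm.eventually_le_of_arc (G : PLQGerm D g y₀) {i : G.ι} {w P : F} {m C : ℝ}
    (hw : w ∈ polarCone (G.normals i))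
    (hP : ∀ᶠ t in 𝓝[>] (0 : ℝ), y₀ + t • P ∈ D ∧ g (y₀ + t • P) ≤ g y₀ + t * m + C * t ^ 2) :
    ∀ᶠ t in 𝓝[>] (0 : ℝ), y₀ + t • w + (1 / 2 * t ^ 2) • P ∈ D ∧
      g (y₀ + t • w + (1 / 2 * t ^ 2) • P) ≤ g y₀ + t * ⟪G.c i, w⟫_ℝ +
        1 / 2 * t ^ 2 * (⟪G.A i w, w⟫_ℝ / (1 - t) + m + C * t / 2) := by
  have h1 : Tendsto (fun t : ℝ => t / (1 - t)) (𝓝[>] 0) (𝓝[>] 0) := by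
    refine tendsto_nhdsWithin_iff.mpr ⟨?_, ?_⟩
    · have h : Tendsto (fun t : ℝ => t) (𝓝[>] 0) (𝓝 0) := nhdsWithin_le_nhds
      have h' := h.div (h.const_sub 1) (by norm_num)
      rwa [zero_div] at h'
    · filter_upwards [Ioo_mem_nhdsGT (zero_lt_one' ℝ)] with t ht
      exact div_pos ht.1 (sub_pos.mpr ht.2)
  filter_upwards [h1.eventually (G.eventually_mem i w hw),
    (tendsto_const_mul_nhdsGT_zero (one_half_pos (α := ℝ))).eventually hP,
    Ioo_mem_nhdsGT (zero_lt_one' ℝ)] with t h2 h3 ht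
  have hne : 1 - t ≠ 0 := (sub_pos.mpr ht.2).ne'
  -- Splitting the arc with weights `1 - t` and `t` makes the reparametrization `t / (1 - t)`
  -- produce the factor `1 / (1 - t)` on the curvature.
  have h4 : y₀ + t • w + (1 / 2 * t ^ 2) • P =
      (1 - t) • (y₀ + (t / (1 - t)) • w) + t • (y₀ + (1 / 2 * t) • P) := by
    rw [smul_add, smul_add, smul_smul, smul_smul, mul_div_cancel₀ t hne]
    module
  rw [h4]
  have h5 : (1 - t) + t = 1 := by ring
  refine ⟨G.convexOn.1 h2.1 h3.1 (sub_pos.mpr ht.2).le ht.1.le h5, ?_⟩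
  refine (G.convexOn.2 h2.1 h3.1 (sub_pos.mpr ht.2).le ht.1.le h5).trans ?_
  simp only [smul_eq_mul]
  rw [h2.2]
  have h6 := mul_le_mul_of_nonneg_left h3.2 ht.1.le
  refine (add_le_add_right h6 _).trans (le_of_eq ?_)
  field_simp
  ring

end Recovery

/-! ### The multiplier set as a polyhedron -/

section Multipliers

variable {E F : Type*} [NormedAddCommGroup E] [InnerProductSpace ℝ E] [FiniteDimensional ℝ E]
  [CompleteSpace E] [NormedAddCommGroup F] [InnerProductSpace ℝ F] [FiniteDimensional ℝ F]
  [CompleteSpace F] {f : E → F} {θ : F → EReal} {x : E}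

/-- The multiplier set is a polyhedron with recoverable data. -/
theorem PLQGerm.exists_multipliers_eq (G : PLQGerm (dom θ) (fun y => (θ y).toReal) (f x))
    (hc : Convex ℝ (epi θ)) (hbot : ∀ y, θ y ≠ ⊥) (v : E) :
    ∃ S : Finset (F × ℝ),
      multipliers f θ x v = polyhedron (fun k : S => k.1.1) (fun k : S => k.1.2) ∧
      ∀ k ∈ S, IsRecoverable (dom θ) (fun y => (θ y).toReal) (f x) (fderiv ℝ f x) v k.1 k.2 := by
  classical
  choose gen hgen using fun i => exists_finset_forall_inner_iff (G.normals i)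
  let b := stdOrthonormalBasis ℝ E
  set L := fderiv ℝ f x
  -- `S₁` encodes the subgradient inequalities on generators of the pieces; `S₂` and `S₃` encode the
  -- adjoint equation as opposite inequalities on a basis.
  let S₁ : Finset (F × ℝ) := Finset.univ.biUnion fun i =>
    (gen i).image fun w => (w, ⟪G.c i, w⟫_ℝ)
  let S₂ : Finset (F × ℝ) := Finset.univ.image fun j => (L (b j), ⟪v, b j⟫_ℝ)
  let S₃ : Finset (F × ℝ) := Finset.univ.image fun j => (L (-b j), ⟪v, -b j⟫_ℝ)
  have hpolar : ∀ i, ∀ w ∈ gen i, w ∈ polarCone (G.normals i) := fun i w hw =>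
    (hgen i w).mpr (Submodule.subset_span hw)
  refine ⟨S₁ ∪ S₂ ∪ S₃, ?_, ?_⟩
  · ext l
    have h1 : l ∈ subdifferential θ (f x) ↔ ∀ i, ∀ w ∈ gen i, ⟪l, w⟫_ℝ ≤ ⟪G.c i, w⟫_ℝ := by
      rw [mem_subdifferential_iff hc hbot G.mem, G.forall_subgradient_iff]
      refine forall_congr' fun i => ⟨fun h w hw => h w (hpolar i w hw), fun h w hw => ?_⟩
      replace hw := (hgen i w).mp hw
      induction hw using Submodule.span_induction with
      | mem g hg => exact h g hg
      | zero => simp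
      | add y z _ _ h1 h2 => rw [inner_add_right, inner_add_right]; linarith
      | smul c y _ h =>
        rw [show c • y = (c : ℝ) • y from rfl, inner_smul_right, inner_smul_right]
        exact mul_le_mul_of_nonneg_left h c.2
    have h2 : ContinuousLinearMap.adjoint L l = v ↔ ∀ j, ⟪l, L (b j)⟫_ℝ = ⟪v, b j⟫_ℝ := by
      constructor
      · rintro rfl j
        rw [ContinuousLinearMap.adjoint_inner_left]
      · intro h
        apply b.repr.injective
        ext j
        rw [b.repr_apply_apply, b.repr_apply_apply, real_inner_comm,
          ContinuousLinearMap.adjoint_inner_left, h, real_inner_comm]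
    constructor
    · rintro ⟨hv, hl⟩ ⟨k, hk⟩
      rw [h2] at hv
      rw [h1] at hl
      rw [Finset.mem_union, Finset.mem_union] at hk
      rcases hk with (hk | hk) | hk
      · obtain ⟨i, -, hi⟩ := Finset.mem_biUnion.mp hk
        obtain ⟨w, hw, rfl⟩ := Finset.mem_image.mp hi
        exact hl i w hw
      · obtain ⟨j, -, rfl⟩ := Finset.mem_image.mp hk
        exact (hv j).le
      · obtain ⟨j, -, rfl⟩ := Finset.mem_image.mp hk
        change ⟪l, L (-b j)⟫_ℝ ≤ ⟪v, -b j⟫_ℝ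
        rw [map_neg, inner_neg_right, inner_neg_right, hv]
    · intro hl
      refine ⟨h2.mpr fun j => le_antisymm ?_ ?_, h1.mpr fun i w hw => ?_⟩
      · exact hl ⟨_, Finset.mem_union_left _ (Finset.mem_union_right _
          (Finset.mem_image_of_mem _ (Finset.mem_univ j)))⟩
      · have : ⟪l, L (-b j)⟫_ℝ ≤ ⟪v, -b j⟫_ℝ := hl ⟨_, Finset.mem_union_right _
          (Finset.mem_image_of_mem _ (Finset.mem_univ j))⟩
        rw [map_neg, inner_neg_right, inner_neg_right] at this
        linarith
      · exact hl ⟨(w, ⟪G.c i, w⟫_ℝ), Finset.mem_union_left _ (Finset.mem_union_left _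
          (Finset.mem_biUnion.mpr ⟨i, Finset.mem_univ i, Finset.mem_image_of_mem _ hw⟩))⟩
  · intro k hk
    rw [Finset.mem_union, Finset.mem_union] at hk
    rcases hk with (hk | hk) | hk
    · obtain ⟨i, -, hi⟩ := Finset.mem_biUnion.mp hk
      obtain ⟨w, hw, rfl⟩ := Finset.mem_image.mp hi
      exact G.isRecoverable (hpolar i w hw)
    · obtain ⟨j, -, rfl⟩ := Finset.mem_image.mp hk
      exact isRecoverable_map G.mem _
    · obtain ⟨j, -, rfl⟩ := Finset.mem_image.mp hk
      exact isRecoverable_map G.mem _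

end Multipliers

section Preliminaries

variable {E F : Type*} [NormedAddCommGroup E] [InnerProductSpace ℝ E] [NormedAddCommGroup F]
  [InnerProductSpace ℝ F] {φ : E → EReal} {f : E → F} {θ : F → EReal} {x v : E} {l : F}

theorem isClosed_polyhedron {ι : Type*} (p : ι → F) (σ : ι → ℝ) : IsClosed (polyhedron p σ) := by
  have : polyhedron p σ = ⋂ k, {u | ⟪u, p k⟫_ℝ ≤ σ k} := by
    ext
    simp [polyhedron]
  rw [this]
  exact isClosed_iInter fun k => isClosed_le (by fun_prop) continuous_const

theorem IsFullySubamenableWith.map_mem_dom (hφ : IsFullySubamenableWith φ f θ x) : f x ∈ dom θ := by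
  have h : φ x < ⊤ := hφ.mem_dom
  rw [hφ.eq_comp.self_of_nhds] at h
  exact h

theorem inner_eq_of_mem_multipliers [CompleteSpace E] [CompleteSpace F]
    (hl : l ∈ multipliers f θ x v) (u : E) :
    ⟪v, u⟫_ℝ = ⟪l, fderiv ℝ f x u⟫_ℝ := by
  rw [← hl.1, ContinuousLinearMap.adjoint_inner_left]

theorem IsFullySubamenableWith.subgradient_of_mem_multipliers [CompleteSpace E]
    [CompleteSpace F]
    (hφ : IsFullySubamenableWith φ f θ x) (hl : l ∈ multipliers f θ x v) :
    ∀ y ∈ dom θ, (θ (f x)).toReal + ⟪l, y - f x⟫_ℝ ≤ (θ y).toReal :=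
  (mem_subdifferential_iff hφ.convex hφ.pwlq.ne_bot hφ.map_mem_dom).mp hl.2

end Preliminaries

/-! ### The chain rule -/

section ChainRule

variable {E F : Type*} [NormedAddCommGroup E] [InnerProductSpace ℝ E] [FiniteDimensional ℝ E]
  [CompleteSpace E] [NormedAddCommGroup F] [InnerProductSpace ℝ F] [FiniteDimensional ℝ F]
  [CompleteSpace F] {φ : E → EReal} {f : E → F} {θ : F → EReal} {x v w : E} {l : F}

namespace IsFullySubamenableWith

/-- Provides compactness of the truncated multiplier set in noncritical directions. -/
theorem isClosed_multipliers (hφ : IsFullySubamenableWith φ f θ x) (v : E) :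
    IsClosed (multipliers f θ x v) := by
  obtain ⟨G⟩ := hφ.pwlq.nonempty_germ hφ.convex hφ.map_mem_dom
  obtain ⟨S, hS, -⟩ := G.exists_multipliers_eq hφ.convex hφ.pwlq.ne_bot v
  rw [hS]
  exact isClosed_polyhedron _ _

/-- The chain rule in critical directions, with multipliers in a fixed ball. -/
theorem exists_radius_chain_rule (hφ : IsFullySubamenableWith φ f θ x)
    (G : PLQGerm (dom θ) (fun y => (θ y).toReal) (f x)) (hl : l ∈ multipliers f θ x v) :
    ∃ R : ℝ, 0 < R ∧ ∀ w, G.IsCritical l (fderiv ℝ f x w) →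
      ∃ u ∈ multipliers f θ x v, ‖u‖ ≤ R ∧
        IsMaxOn (fun u => ⟪u, secondDeriv f x w w⟫_ℝ) (multipliers f θ x v) u ∧
        ∃ a : ℝ, secondSubderivative θ (f x) l (fderiv ℝ f x w) = a ∧
          secondSubderivative φ x v w = ((a + ⟪u, secondDeriv f x w w⟫_ℝ : ℝ) : EReal) := by
  have hbot := hφ.pwlq.ne_bot
  obtain ⟨S, hS, hrec⟩ := G.exists_multipliers_eq hφ.convex hbot v
  have hne : (polyhedron (fun k : S => k.1.1) (fun k : S => k.1.2)).Nonempty :=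
    ⟨l, by rw [← hS]; exact hl⟩
  obtain ⟨R, hR, hmax⟩ := exists_radius_isMaxOn_polyhedron _ _ hne
  rw [← hS] at hmax
  refine ⟨R, hR, fun w ⟨i, hi, hci⟩ => ?_⟩
  set q := secondDeriv f x w w
  set a := ⟪G.A i (fderiv ℝ f x w), fderiv ℝ f x w⟫_ℝ with ha
  have hvw : ⟪v, w⟫_ℝ = ⟪G.c i, fderiv ℝ f x w⟫_ℝ := by
    rw [hci, inner_eq_of_mem_multipliers hl]
  have hlow : ∀ u ∈ multipliers f θ x v, ((a + ⟪u, q⟫_ℝ : ℝ) : EReal) ≤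
      secondSubderivative φ x v w := by
    intro u hu
    have hu2 : secondSubderivative θ (f x) u (fderiv ℝ f x w) = (a : EReal) :=
      G.secondSubderivative_eq hbot (hφ.subgradient_of_mem_multipliers hu) hi (by
        rw [← hvw, inner_eq_of_mem_multipliers hu])
    refine EReal.ge_of_forall_gt_iff_ge.mp fun z hz => ?_
    rw [EReal.coe_lt_coe_iff] at hz
    have := coe_add_inner_le_secondSubderivative (w := w) (M := z - ⟪u, q⟫_ℝ) hφ.eq_comp
      hφ.twiceDiff hbot G.mem (inner_eq_of_mem_multipliers hu) (by
        rw [hu2, EReal.coe_lt_coe_iff]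
        linarith)
    rwa [sub_add_cancel] at this
  obtain ⟨C, hC⟩ := exists_secondSubderivative_le G hbot hφ.eq_comp hφ.twiceDiff hφ.msqc v w
  -- The straight arc (`z = 0`, `P = 0`) already bounds the second subderivative above by a finite
  -- number, and the lower estimate turns this into dual feasibility.
  have hbdd : BddAbove ((fun u => ⟪u, q⟫_ℝ) '' multipliers f θ x v) := by
    have hup := hC 0 0 (fun _ => a) a tendsto_const_nhds (by
      filter_upwards [G.eventually_mem i _ hi] with t ht
      rw [smul_zero, add_zero, hvw, ha]
      exact ⟨ht.1, ht.2.le⟩)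
    refine ⟨C * ‖q + fderiv ℝ f x 0 - 0‖, ?_⟩
    rintro _ ⟨u, hu, rfl⟩
    have := (hlow u hu).trans hup
    rw [EReal.coe_le_coe_iff, inner_zero_right] at this
    change ⟪u, q⟫_ℝ ≤ _
    linarith
  obtain ⟨u, hu, huR, humax, c, hc, hcq, hcσ⟩ := hmax q hbdd
  refine ⟨u, hu, huR, humax, a,
    G.secondSubderivative_eq hbot (hφ.subgradient_of_mem_multipliers hl) hi hci, ?_⟩
  refine le_antisymm ?_ (hlow u hu)
  obtain ⟨z, C', hz⟩ := IsRecoverable.sum G.convexOn G.mem Finset.univ hc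
    (fun k : S => hrec k.1 k.2)
  rw [hcq] at hz
  set m := ∑ k : S, c k * k.1.2
  have hlim : Tendsto (fun t : ℝ => a / (1 - t) + (m + ⟪v, z⟫_ℝ) + C' * t / 2) (𝓝[>] 0)
      (𝓝 (a + (m + ⟪v, z⟫_ℝ))) := by
    have h : Tendsto (fun t : ℝ => t) (𝓝[>] 0) (𝓝 0) := nhdsWithin_le_nhds
    have h1 : Tendsto (fun t : ℝ => a / (1 - t)) (𝓝[>] 0) (𝓝 (a / (1 - 0))) :=
      tendsto_const_nhds.div (h.const_sub 1) (by norm_num)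
    have h2 := (h1.add_const (m + ⟪v, z⟫_ℝ)).add ((h.const_mul C').div_const 2)
    convert h2 using 2
    ring
  -- With `P = q + L z` the mismatch vanishes and `⟪v, z⟫` cancels, leaving `a + m` with `m ≤ ⟪u,
  -- q⟫`.
  have hup := hC z (q + fderiv ℝ f x z) _ _ hlim (by
    rw [hvw]
    exact G.eventually_le_of_arc hi hz)
  refine hup.trans ?_
  rw [EReal.coe_le_coe_iff, sub_self, norm_zero]
  linarith

/-- In noncritical directions the second subderivative of the composition is infinite. -/
theorem secondSubderivative_eq_top (hφ : IsFullySubamenableWith φ f θ x)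
    (G : PLQGerm (dom θ) (fun y => (θ y).toReal) (f x)) (hl : l ∈ multipliers f θ x v)
    (hw : ¬ G.IsCritical l (fderiv ℝ f x w)) : secondSubderivative φ x v w = ⊤ := by
  have hbot := hφ.pwlq.ne_bot
  have htop := G.secondSubderivative_eq_top hbot (hφ.subgradient_of_mem_multipliers hl) hw
  refine top_le_iff.mp (EReal.ge_of_forall_gt_iff_ge.mp fun z _ => ?_)
  have := coe_add_inner_le_secondSubderivative (w := w) (M := z - ⟪l, secondDeriv f x w w⟫_ℝ)
    hφ.eq_comp hφ.twiceDiff hbot G.mem (inner_eq_of_mem_multipliers hl) (by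
      rw [htop]
      exact EReal.coe_lt_top _)
  rwa [sub_add_cancel] at this

end IsFullySubamenableWith

end ChainRule

end VarAnalysis

theorem corollary5p3 {n m : ℕ}
    (φ : EuclideanSpace ℝ (Fin n) → EReal)
    (f : EuclideanSpace ℝ (Fin n) → EuclideanSpace ℝ (Fin m))
    (θ : EuclideanSpace ℝ (Fin m) → EReal)
    (x v : EuclideanSpace ℝ (Fin n))
    (hφ : VarAnalysis.IsFullySubamenableWith φ f θ x)
    (hv : v ∈ VarAnalysis.subdifferential φ x)
    (l : EuclideanSpace ℝ (Fin m)) (hl : l ∈ VarAnalysis.multipliers f θ x v) :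
    -- the chain rule, for all directions `w`, with a supremum in `(-∞, ∞]`
    (∀ w : EuclideanSpace ℝ (Fin n),
      VarAnalysis.secondSubderivative φ x v w =
        VarAnalysis.secondSubderivative θ (f x) l (fderiv ℝ f x w) +
          ⨆ μ ∈ VarAnalysis.multipliers f θ x v,
            ((inner ℝ μ (VarAnalysis.secondDeriv f x w w) : ℝ) : EReal)) ∧
    -- the supremum is a maximum for every critical direction
    (∀ w ∈ VarAnalysis.criticalCone φ x v, ∃ μ₀ ∈ VarAnalysis.multipliers f θ x v,
      IsMaxOn (fun μ => (inner ℝ μ (VarAnalysis.secondDeriv f x w w) : ℝ))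
        (VarAnalysis.multipliers f θ x v) μ₀) ∧
    -- for large `r` the maximum may be taken over the multipliers in the ball of radius `r`
    (∃ rbar : ℝ, 0 < rbar ∧ ∀ r : ℝ, rbar < r → ∀ w : EuclideanSpace ℝ (Fin n),
      ∃ μ₀ ∈ VarAnalysis.multipliers f θ x v ∩ Metric.closedBall 0 r,
        IsMaxOn (fun μ => (inner ℝ μ (VarAnalysis.secondDeriv f x w w) : ℝ))
          (VarAnalysis.multipliers f θ x v ∩ Metric.closedBall 0 r) μ₀ ∧
        VarAnalysis.secondSubderivative φ x v w =
          VarAnalysis.secondSubderivative θ (f x) l (fderiv ℝ f x w) +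
            ((inner ℝ μ₀ (VarAnalysis.secondDeriv f x w w) : ℝ) : EReal)) := by
  obtain ⟨G⟩ := hφ.pwlq.nonempty_germ hφ.convex hφ.map_mem_dom
  obtain ⟨R, hR, hcrit⟩ := hφ.exists_radius_chain_rule G hl
  -- `R` accommodates the maximizers in critical directions; `‖l‖` keeps the truncated set nonempty.
  refine ⟨fun w => ?_, fun w hw => ?_, R + ‖l‖, by positivity, fun r hr w => ?_⟩
  · by_cases hw : G.IsCritical l (fderiv ℝ f x w)
    · obtain ⟨u, hu, -, hmax, a, ha, hval⟩ := hcrit w hw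
      rw [hval, ha, EReal.coe_add]
      congr 1
      exact le_antisymm
        (le_iSup₂_of_le (f := fun (μ : EuclideanSpace ℝ (Fin m)) _ =>
          ((inner ℝ μ (VarAnalysis.secondDeriv f x w w) : ℝ) : EReal)) u hu le_rfl)
        (iSup₂_le fun μ hμ => EReal.coe_le_coe_iff.mpr (hmax hμ))
    · rw [hφ.secondSubderivative_eq_top G hl hw, G.secondSubderivative_eq_top hφ.pwlq.ne_bot
        (hφ.subgradient_of_mem_multipliers hl) hw, EReal.top_add_of_ne_bot]
      -- In `EReal`, `⊤ + ⊥ = ⊥`, so the supremum must be bounded below, here by its term at `l`.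
      refine ((EReal.bot_lt_coe (inner ℝ l (VarAnalysis.secondDeriv f x w w))).trans_le ?_).ne'
      exact le_iSup₂_of_le (f := fun (μ : EuclideanSpace ℝ (Fin m)) _ =>
        ((inner ℝ μ (VarAnalysis.secondDeriv f x w w) : ℝ) : EReal)) l hl le_rfl
  · obtain ⟨u, hu, -, hmax, -⟩ := hcrit w (G.isCritical_of_mem_criticalCone hφ.pwlq.ne_bot
      hφ.eq_comp hφ.twiceDiff (hφ.subgradient_of_mem_multipliers hl)
      (VarAnalysis.inner_eq_of_mem_multipliers hl) hw)
    exact ⟨u, hu, hmax⟩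
  · by_cases hw : G.IsCritical l (fderiv ℝ f x w)
    · obtain ⟨u, hu, huR, hmax, a, ha, hval⟩ := hcrit w hw
      refine ⟨u, ⟨hu, ?_⟩, hmax.on_subset Set.inter_subset_left, by rw [hval, ha, EReal.coe_add]⟩
      rw [mem_closedBall_zero_iff]
      linarith [norm_nonneg l]
    · have hcomp : IsCompact (VarAnalysis.multipliers f θ x v ∩ Metric.closedBall 0 r) :=
        (isCompact_closedBall 0 r).inter_left (hφ.isClosed_multipliers v)
      have hne : (VarAnalysis.multipliers f θ x v ∩ Metric.closedBall 0 r).Nonempty :=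
        ⟨l, hl, by rw [mem_closedBall_zero_iff]; linarith⟩
      obtain ⟨u, hu, hmax⟩ := hcomp.exists_isMaxOn hne
        (f := fun μ => (inner ℝ μ (VarAnalysis.secondDeriv f x w w) : ℝ)) (by fun_prop)
      refine ⟨u, hu, hmax, ?_⟩
      rw [hφ.secondSubderivative_eq_top G hl hw, G.secondSubderivative_eq_top hφ.pwlq.ne_bot
        (hφ.subgradient_of_mem_multipliers hl) hw, EReal.top_add_coe]
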